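/- Let $l\ge 1$ and $a_0,\dots,a_{l-1}\in\mathbb R$, put $a_l=1$, and consider in polar coordinates $(\rho,\varphi)$, $\rho>0$, of the plane the system $$\dot\rho=-\rho\Big(\rho^{-2l}+\sum_{j=0}^{l-1}a_j\rho^{-2j}\Big),\qquad \dot\varphi=1.$$ A trajectory is a maximal solution. A part $\Gamma$ of a trajectory near infinity is a forward or backward semitrajectory, starting at (and including) one of the points of the trajectory, on which $\rho$ is unbounded. Positive functions $g,f$ are called comparable as $\varphi\to\pm\infty$ if $c_1f\le g\le c_2f$ near $\pm\infty$ for some constants $c_1,c_2>0$. For an unbounded set $A\subset\mathbb R^2$ at positive distance from the origin, $\dim_B A=d$ means that the bounded set $\Phi(A)$, where $\Phi(x)=x/|x|^2$, has upper and lower box (Minkowski) dimension $d$, that is, with $|B_\varepsilon|$ the area of the $\varepsilon$-neighbourhood of $B=\Phi(A)$, $$\inf\Big\{s>0:\limsup_{\varepsilon\to0^+}\frac{|B_\varepsilon|}{\varepsilon^{2-s}}=0\Big\}=\inf\Big\{s>0:\liminf_{\varepsilon\to0^+}\frac{|B_\varepsilon|}{\varepsilon^{2-s}}=0\Big\}=d.$$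 There is $R>0$, depending only on the system, such that for every point of a trajectory with $\rho\ge R$ one of the two semitrajectories starting at that point is a part of the trajectory near infinity. Moreover, let $\Gamma$ be any part of a trajectory near infinity. (a) If $a_0\ne0$, then $\Gamma$ is a spiral of exponential type: $\Gamma$ is the graph $\rho=g(\varphi)$, $\varphi\ge\varphi_0$, of a strictly increasing function if $a_0<0$, respectively the graph $\rho=g(\varphi)$, $\varphi\le\varphi_0$, of a strictly decreasing function if $a_0>0$; moreover $g(\varphi)\to\infty$ and $g(\varphi)$ is comparable with $e^{-a_0\varphi}$ as $\varphi\to+\infty$, respectively as $\varphi\to-\infty$. Furthermore $\dim_B\Gamma=1$. (b) If $1\le k\le l$, $a_0=\dots=a_{k-1}=0$ and $a_k\ne0$, then $\Gamma$ is the graph $\rho=g(\varphi)$, $\varphi\ge\varphi_0$, of a strictly increasing function if $a_k<0$, respectively the graph $\rho=g(\varphi)$, $\varphi\le\varphi_0$, of a strictly decreasing function if $a_k>0$; moreover $g(\varphi)\to\infty$ and $g(\varphi)$ is comparable with $|\varphi|^{1/(2k)}$ as $\varphi\to+\infty$, respectively as $\varphi\to-\infty$. Furthermore $$\dim_B\Gamma=\frac{4k}{2k+1}.$$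 -/

import Mathlib

open Set Filter Topology MeasureTheory

noncomputable section

/-! ### Minkowski contents and box dimension -/

/-- Upper `s`-dimensional Minkowski content of a subset of `ℝⁿ`. -/
def upperMinkowskiContent {n : ℕ} (s : ℝ) (A : Set (EuclideanSpace ℝ (Fin n))) : ENNReal :=
  limsup (fun ε : ℝ => volume (Metric.thickening ε A) / ENNReal.ofReal (ε ^ ((n : ℝ) - s)))
    (𝓝[>] (0 : ℝ))

/-- Lower `s`-dimensional Minkowski content of a subset of `ℝⁿ`. -/
def lowerMinkowskiContent {n : ℕ} (s : ℝ) (A : Set (EuclideanSpace ℝ (Fin n))) : ENNReal :=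
  liminf (fun ε : ℝ => volume (Metric.thickening ε A) / ENNReal.ofReal (ε ^ ((n : ℝ) - s)))
    (𝓝[>] (0 : ℝ))

/-- Upper box dimension (of a nonempty bounded set; the set of exponents is then nonempty). -/
def upperBoxDim {n : ℕ} (A : Set (EuclideanSpace ℝ (Fin n))) : ℝ :=
  sInf {s : ℝ | 0 < s ∧ upperMinkowskiContent s A = 0}

/-- Lower box dimension (of a nonempty bounded set). -/
def lowerBoxDim {n : ℕ} (A : Set (EuclideanSpace ℝ (Fin n))) : ℝ :=
  sInf {s : ℝ | 0 < s ∧ lowerMinkowskiContent s A = 0}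

/-- The nonempty bounded set `A` has box dimension `d`. -/
def HasBoxDim {n : ℕ} (A : Set (EuclideanSpace ℝ (Fin n))) (d : ℝ) : Prop :=
  A.Nonempty ∧ Bornology.IsBounded A ∧ upperBoxDim A = d ∧ lowerBoxDim A = d

/-- The unbounded set `A`, at positive distance from the origin, has box dimension `d`:
its image under the geometric inversion `x ↦ x / ‖x‖²` has box dimension `d`. -/
def HasBoxDimUnbounded {n : ℕ} (A : Set (EuclideanSpace ℝ (Fin n))) (d : ℝ) : Prop :=
  ¬ Bornology.IsBounded A ∧ 0 < Metric.infDist 0 A ∧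
    HasBoxDim (EuclideanGeometry.inversion (0 : EuclideanSpace ℝ (Fin n)) 1 '' A) d

/-! ### Trajectories of the inverted Hopf-Takens normal form -/

/-- Radial component `-ρ (ρ^(-2l) + ∑_{j<l} a_j ρ^(-2j))` of the vector field. -/
def hopfTakensRadial (l : ℕ) (a : ℕ → ℝ) (ρ : ℝ) : ℝ :=
  -ρ * (ρ ^ (-(2 * (l : ℤ))) + ∑ j ∈ Finset.range l, a j * ρ ^ (-(2 * (j : ℤ))))

/-- `(ρ, φ)` solves the system in polar coordinates on the open interval `J`. -/
structure IsHopfTakensSolution (l : ℕ) (a : ℕ → ℝ) (J : Set ℝ) (ρ φ : ℝ → ℝ) : Prop where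
  nonempty : J.Nonempty
  isOpen : IsOpen J
  ordConnected : J.OrdConnected
  pos : ∀ t ∈ J, 0 < ρ t
  hasDerivAt_radius : ∀ t ∈ J, HasDerivAt ρ (hopfTakensRadial l a (ρ t)) t
  hasDerivAt_angle : ∀ t ∈ J, HasDerivAt φ 1 t

/-- A trajectory is a solution that has no extension to a larger open interval. -/
structure IsHopfTakensTrajectory (l : ℕ) (a : ℕ → ℝ) (J : Set ℝ) (ρ φ : ℝ → ℝ) : Prop
    extends IsHopfTakensSolution l a J ρ φ where
  maximal : ∀ (J' : Set ℝ) (ρ' φ' : ℝ → ℝ), IsHopfTakensSolution l a J' ρ' φ' →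
    J ⊆ J' → EqOn ρ' ρ J → EqOn φ' φ J → J' = J

/-- The restriction of `(ρ, φ)` to the set of times `S` is a part of a trajectory near infinity:
a forward or backward semitrajectory, starting at a point of the trajectory, that is unbounded. -/
def IsPartNearInfinity (l : ℕ) (a : ℕ → ℝ) (S : Set ℝ) (ρ φ : ℝ → ℝ) : Prop :=
  ∃ J : Set ℝ, IsHopfTakensTrajectory l a J ρ φ ∧
    ∃ t₀ ∈ J, (S = J ∩ Ici t₀ ∨ S = J ∩ Iic t₀) ∧ ¬ BddAbove (ρ '' S)

/-- The planar curve with polar coordinates `(ρ t, φ t)`, `t ∈ S`. -/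
def polarCurve (S : Set ℝ) (ρ φ : ℝ → ℝ) : Set (EuclideanSpace ℝ (Fin 2)) :=
  (fun t => !₂[ρ t * Real.cos (φ t), ρ t * Real.sin (φ t)]) '' S

/-! ### Spirals and comparability -/

/-- `f` and `g` are comparable along the filter `F`. -/
def Comparable (F : Filter ℝ) (f g : ℝ → ℝ) : Prop :=
  ∃ c₁ > 0, ∃ c₂ > 0, ∀ᶠ x in F, c₁ * g x ≤ f x ∧ f x ≤ c₂ * g x

/-- The curve with polar coordinates `(ρ t, φ t)`, `t ∈ S`, is a spiral `ρ = g(φ)`, `φ ≥ φ₀`,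
increasing to infinity as `φ → +∞`, and `g` is comparable with `f` as `φ → +∞`. -/
def IsForwardSpiralComparable (S : Set ℝ) (ρ φ f : ℝ → ℝ) : Prop :=
  ∃ (φ₀ : ℝ) (g : ℝ → ℝ), φ '' S = Ici φ₀ ∧ (∀ t ∈ S, ρ t = g (φ t)) ∧
    StrictMonoOn g (Ici φ₀) ∧ Tendsto g atTop atTop ∧ Comparable atTop g f

/-- The curve with polar coordinates `(ρ t, φ t)`, `t ∈ S`, is a spiral `ρ = g(φ)`, `φ ≤ φ₀`,
increasing to infinity as `φ` decreases to `-∞`, and `g` is comparable with `f` as `φ → -∞`. -/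
def IsBackwardSpiralComparable (S : Set ℝ) (ρ φ f : ℝ → ℝ) : Prop :=
  ∃ (φ₀ : ℝ) (g : ℝ → ℝ), φ '' S = Iic φ₀ ∧ (∀ t ∈ S, ρ t = g (φ t)) ∧
    StrictAntiOn g (Iic φ₀) ∧ Tendsto g atBot atTop ∧ Comparable atBot g f

end

/-! Since the angle has speed 1, it is time up to a constant, and the radius as a function of the
angle solves a scalar autonomous equation `ρ' = F(ρ)`. If `a k` is the first nonzero coefficient,
then `F(ρ) ρ^(2k) = -a k ρ + O(1/ρ)`. Reversing time reduces `a k > 0` to the case of a radius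
growing forwards.

Dynamics. A level `c ≥ ρ t₀` with `F c ≤ 0` is a barrier, so an unbounded forward semitrajectory has
`F > 0` on all of `[ρ t₀, ∞)`. Hence it is strictly monotone from its first point on, and the sign
of `a k` is determined. Linear growth of `F` there rules out blow-up in finite time. For `k ≥ 1` the
derivative of `ρ^(2k)` lies between positive constants, so `ρ` is comparable with `s^(1/(2k))`. For
`k = 0` the function `log ρ - κ s` has derivative `O(ρ^(-2))`, with bounded integral, so `ρ` is
comparable with `exp (κ s)`. These facts are collected in `SpiralGrowth`.

Dimension. Inversion gives a spiral of radius `r = 1/ρ` winding into the origin. For `k ≥ 1` put `α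
= 1/(2k)`, so that `r` is of order `s^(-α)` and consecutive turns are `O(s^(-1-α))` apart. At scale
`ε` the critical parameter is `s ≈ ε^(-1/(1+α))`. Earlier turns have total length of order `s^(1-α)`
and contribute area at most of order `ε s^(1-α)`; later turns stay in a disc of radius of order
`s^(-α)`, which their neighbourhood essentially fills. Both contributions are of order `ε^(2 -
2/(1+α))`, whence the dimension `2/(1+α) = 4k/(2k+1)`. For `k = 0` the curve has finite length, and
the same upper estimate with `α = 1` gives area `O(ε)`; the lower bound holds because the norms on
the curve fill an interval. -/

/-! ### Scalar autonomous equations on the half-line `(0, ∞)` -/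

/-- `ρ` is a positive solution of `ρ' = F(ρ)` on the open interval `J`. -/
structure IsPositiveSolution (F : ℝ → ℝ) (J : Set ℝ) (ρ : ℝ → ℝ) : Prop where
  isOpen : IsOpen J
  ordConnected : J.OrdConnected
  pos : ∀ t ∈ J, 0 < ρ t
  hasDerivAt : ∀ t ∈ J, HasDerivAt ρ (F (ρ t)) t

namespace IsPositiveSolution

variable {F : ℝ → ℝ} {J : Set ℝ} {ρ : ℝ → ℝ} {t₀ : ℝ}

theorem Icc_subset (h : IsPositiveSolution F J ρ) {s t : ℝ} (hs : s ∈ J) (ht : t ∈ J) :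
    Icc s t ⊆ J := h.ordConnected.out hs ht

theorem continuousOn (h : IsPositiveSolution F J ρ) : ContinuousOn ρ J :=
  fun t ht => (h.hasDerivAt t ht).continuousAt.continuousWithinAt

theorem exists_lipschitzOnWith (hF : ∀ r > 0, ContDiffAt ℝ 1 F r) {K : Set ℝ} (hK : IsCompact K)
    (hpos : ∀ r ∈ K, 0 < r) : ∃ C, LipschitzOnWith C F K := by
  refine LocallyLipschitzOn.exists_lipschitzOnWith_of_compact hK fun r hr => ?_
  obtain ⟨C, s, hs, hl⟩ := (hF r (hpos r hr)).exists_lipschitzOnWith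
  exact ⟨C, s, mem_nhdsWithin_of_mem_nhds hs, hl⟩

/-- A solution does not cross upwards a level at which the vector field is nonpositive. -/
theorem le_of_nonpos (h : IsPositiveSolution F J ρ) (hF : ∀ r > 0, ContDiffAt ℝ 1 F r)
    (ht₀ : t₀ ∈ J) {c : ℝ} (hc : ρ t₀ ≤ c) (hFc : F c ≤ 0) {t : ℝ} (ht : t ∈ J) (htt : t₀ ≤ t) :
    ρ t ≤ c := by
  rcases hFc.lt_or_eq with hlt | heq
  · refine image_le_of_deriv_right_lt_deriv_boundary' (f := ρ) (f' := fun x => F (ρ x))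
      (B := fun _ => c) (B' := fun _ => 0) (a := t₀) (b := t)
      (h.continuousOn.mono (h.Icc_subset ht₀ ht))
      (fun x hx => (h.hasDerivAt x (h.Icc_subset ht₀ ht (Ico_subset_Icc_self hx))).hasDerivWithinAt)
      hc continuousOn_const (fun x _ => hasDerivWithinAt_const ..) ?_ ⟨htt, le_rfl⟩
    intro x _ hx
    simpa [hx] using hlt
  -- If `F c = 0`, the constant `c` is itself a solution; by uniqueness `ρ` cannot leave the level
  -- `c` after reaching it at some time `t₁`.
  · by_contra! hcon
    have hsub := h.Icc_subset ht₀ ht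
    obtain ⟨t₁, ht₁, hρ₁⟩ := intermediate_value_Icc htt (h.continuousOn.mono hsub) ⟨hc, hcon.le⟩
    have hsub' : Icc t₁ t ⊆ J := h.Icc_subset (hsub ht₁) ht
    have hcomp : IsCompact (ρ '' Icc t₁ t) := isCompact_Icc.image_of_continuousOn
      (h.continuousOn.mono hsub')
    obtain ⟨C, hC⟩ := exists_lipschitzOnWith hF hcomp (by
      rintro _ ⟨x, hx, rfl⟩; exact h.pos x (hsub' hx))
    have hmem : c ∈ ρ '' Icc t₁ t := ⟨t₁, ⟨le_rfl, ht₁.2⟩, hρ₁⟩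
    have := ODE_solution_unique_of_mem_Icc_right (v := fun _ => F) (s := fun _ => ρ '' Icc t₁ t)
      (f := ρ) (g := fun _ => c) (a := t₁) (b := t) (fun _ _ => hC)
      (h.continuousOn.mono hsub')
      (fun x hx => (h.hasDerivAt x (hsub' (Ico_subset_Icc_self hx))).hasDerivWithinAt)
      (fun x hx => mem_image_of_mem _ (Ico_subset_Icc_self hx)) continuousOn_const
      (fun x _ => by simpa [heq] using hasDerivWithinAt_const x (Ici x) c) (fun _ _ => hmem) hρ₁
    have h2 := this ⟨ht₁.2, le_rfl⟩
    simp only at h2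
    linarith

/-- A level above the initial value where `F` is nonpositive would bound all later values. This
needs no lower bound on how large `c` is, which is why monotonicity holds from the very first point.
-/
theorem pos_of_not_bddAbove (h : IsPositiveSolution F J ρ) (hF : ∀ r > 0, ContDiffAt ℝ 1 F r)
    (ht₀ : t₀ ∈ J) (hunb : ¬ BddAbove (ρ '' (J ∩ Ici t₀))) {c : ℝ} (hc : ρ t₀ ≤ c) : 0 < F c := by
  by_contra! hFc
  refine hunb ⟨c, ?_⟩
  rintro _ ⟨t, ht, rfl⟩
  exact h.le_of_nonpos hF ht₀ hc hFc ht.1 ht.2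

theorem le_of_pos (h : IsPositiveSolution F J ρ) (ht₀ : t₀ ∈ J) (hpos : ∀ c, ρ t₀ ≤ c → 0 < F c)
    {t : ℝ} (ht : t ∈ J) (htt : t₀ ≤ t) : ρ t₀ ≤ ρ t := by
  refine image_le_of_deriv_right_lt_deriv_boundary' (f := fun _ => ρ t₀) (f' := fun _ => 0)
      (B := ρ) (B' := fun x => F (ρ x)) (a := t₀) (b := t) continuousOn_const
      (fun x _ => hasDerivWithinAt_const ..) le_rfl (h.continuousOn.mono (h.Icc_subset ht₀ ht))
      (fun x hx => (h.hasDerivAt x (h.Icc_subset ht₀ ht (Ico_subset_Icc_self hx))).hasDerivWithinAt)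
      ?_ ⟨htt, le_rfl⟩
  intro x _ hx
  exact hpos _ hx.le

theorem strictMonoOn (h : IsPositiveSolution F J ρ) (ht₀ : t₀ ∈ J)
    (hpos : ∀ c, ρ t₀ ≤ c → 0 < F c) : StrictMonoOn ρ (J ∩ Ici t₀) := by
  have hoc : (J ∩ Ici t₀).OrdConnected := h.ordConnected.inter ordConnected_Ici
  refine strictMonoOn_of_deriv_pos hoc.convex (h.continuousOn.mono inter_subset_left) ?_
  intro x hx
  have hx' := interior_subset hx
  rw [(h.hasDerivAt x hx'.1).deriv]
  exact hpos _ (h.le_of_pos ht₀ hpos hx'.1 hx'.2)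

/-- A solution with a finite positive limit at the right end point can be continued. -/
theorem exists_extension (h : IsPositiveSolution F J ρ) (hF : ∀ r > 0, ContDiffAt ℝ 1 F r)
    {b L : ℝ} (hJb : J ⊆ Iio b) (hIco : Ico t₀ b ⊆ J) (htb : t₀ < b) (hL : 0 < L)
    (hlim : Tendsto ρ (𝓝[<] b) (𝓝 L)) :
    ∃ J' ρ', IsPositiveSolution F J' ρ' ∧ J ⊆ J' ∧ b ∈ J' ∧ EqOn ρ' ρ J := by
  obtain ⟨α, hαb, ε, hε, hα⟩ :=
    (hF L hL).exists_forall_mem_closedBall_exists_eq_forall_mem_Ioo_hasDerivAt₀ b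
  have hαc : ContinuousAt α b := (hα b ⟨by linarith, by linarith⟩).continuousAt
  obtain ⟨δ, hδ, hδpos⟩ := Metric.eventually_nhds_iff.1
    (hαc.eventually (lt_mem_nhds (by rw [hαb]; exact hL)))
  set η := min ε δ with hη
  have hη0 : 0 < η := lt_min hε hδ
  have hηε : η ≤ ε := min_le_left _ _
  have hηδ : η ≤ δ := min_le_right _ _
  -- The old solution is glued at `b` to the local Picard–Lindelöf solution `α` with `α b = L`; `η`
  -- keeps `α` both defined and positive.
  set ρ' : ℝ → ℝ := fun t => if t < b then ρ t else α t with hρ'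
  have heq : ∀ t < b, ρ' =ᶠ[𝓝 t] ρ := fun t ht => by
    filter_upwards [Iio_mem_nhds ht] with x hx
    simp only [hρ']; exact if_pos hx
  have heq' : ∀ t, b < t → ρ' =ᶠ[𝓝 t] α := fun t ht => by
    filter_upwards [Ioi_mem_nhds ht] with x hx
    simp only [hρ']; exact if_neg (not_lt.2 (le_of_lt hx))
  have hρ'b : ρ' b = L := by simp [hρ', hαb]
  have hIoo : Ioo t₀ b ⊆ J := Ioo_subset_Ico_self.trans hIco
  have hdl : ∀ t ∈ J, HasDerivAt ρ' (F (ρ' t)) t := fun t ht => by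
    have h1 := h.hasDerivAt t ht
    rw [← (heq t (hJb ht)).eq_of_nhds] at h1
    exact h1.congr_of_eventuallyEq (heq t (hJb ht))
  have hlim' : Tendsto ρ' (𝓝[<] b) (𝓝 L) := by
    refine hlim.congr' ?_
    filter_upwards [self_mem_nhdsWithin] with x hx
    simp only [hρ']; exact (if_pos hx).symm
  have hdb : HasDerivAt ρ' (F (ρ' b)) b := by
    rw [hρ'b]
    -- The left derivative at `b` is the limit of the derivatives `F (ρ t)`, which is `F L` by
    -- continuity of `F`.
    have hleft : HasDerivWithinAt ρ' (F L) (Iic b) b := by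
      refine hasDerivWithinAt_Iic_of_tendsto_deriv (s := Ioo t₀ b)
        (fun t ht => (hdl t (hIoo ht)).differentiableAt.differentiableWithinAt) ?_
        (Ioo_mem_nhdsLT htb) ?_
      · unfold ContinuousWithinAt
        rw [hρ'b]
        exact hlim'.mono_left (nhdsWithin_mono _ fun x hx => hx.2)
      · refine (((hF L hL).continuousAt.tendsto).comp hlim').congr' ?_
        filter_upwards [Ioo_mem_nhdsLT htb] with x hx
        exact (hdl x (hIoo hx)).deriv.symm
    have hright : HasDerivWithinAt ρ' (F L) (Ici b) b := by
      have h1 := (hα b ⟨by linarith, by linarith⟩).hasDerivWithinAt (s := Ici b)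
      rw [hαb] at h1
      refine h1.congr (fun x hx => ?_) ?_
      · simp only [hρ']; exact if_neg (not_lt.2 hx)
      · simp [hρ']
    have := hleft.union hright
    rwa [Iic_union_Ici, hasDerivWithinAt_univ] at this
  refine ⟨J ∪ Ioo t₀ (b + η), ρ', ⟨h.isOpen.union isOpen_Ioo, ?_, ?_, ?_⟩, subset_union_left,
    Or.inr ⟨htb, by linarith⟩, fun t ht => (heq t (hJb ht)).eq_of_nhds⟩
  · obtain ⟨x, hx⟩ := exists_between htb
    exact (IsPreconnected.union (t := Ioo t₀ (b + η)) x (hIoo hx) ⟨hx.1, by linarith [hx.2]⟩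
      h.ordConnected.isPreconnected isPreconnected_Ioo).ordConnected
  · have key : ∀ t ∈ J, 0 < ρ' t := fun t ht => by
      rw [(heq t (hJb ht)).eq_of_nhds]; exact h.pos t ht
    rintro t (ht | ht)
    · exact key t ht
    · rcases lt_or_ge t b with h1 | h1
      · exact key t (hIoo ⟨ht.1, h1⟩)
      · simp only [hρ', if_neg (not_lt.2 h1)]
        refine hδpos ?_
        rw [Real.dist_eq, abs_lt]
        constructor <;> linarith [ht.2]
  · rintro t (ht | ht)
    · exact hdl t ht
    · rcases lt_trichotomy t b with h1 | h1 | h1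
      · exact hdl t (hIoo ⟨ht.1, h1⟩)
      · rw [h1]; exact hdb
      · rw [(heq' t h1).eq_of_nhds]
        exact (hα t ⟨by linarith, by linarith [ht.2]⟩).congr_of_eventuallyEq (heq' t h1)

/-- A maximal increasing solution of an equation with at most linear growth is global. -/
theorem Ici_subset (h : IsPositiveSolution F J ρ) (hF : ∀ r > 0, ContDiffAt ℝ 1 F r)
    (hmax : ∀ J' ρ', IsPositiveSolution F J' ρ' → J ⊆ J' → EqOn ρ' ρ J → J' = J)
    (ht₀ : t₀ ∈ J) (hpos : ∀ c, ρ t₀ ≤ c → 0 < F c) {C : ℝ} (hC : ∀ c, ρ t₀ ≤ c → F c ≤ C * c) :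
    Ici t₀ ⊆ J := by
  intro t₁ ht₁
  by_contra hnot
  have hbdd : BddAbove J := ⟨t₁, fun x hx => by
    by_contra! hlt
    exact hnot (h.Icc_subset ht₀ hx ⟨ht₁, hlt.le⟩)⟩
  set b := sSup J with hb
  have hbJ : b ∉ J := fun hmem => by
    obtain ⟨ε, hε, hsub⟩ := Metric.isOpen_iff.1 h.isOpen b hmem
    have : b + ε / 2 ∈ J := hsub (by
      rw [Metric.mem_ball, Real.dist_eq, add_sub_cancel_left, abs_of_pos (by linarith)]; linarith)
    linarith [le_csSup hbdd this]
  have hJb : J ⊆ Iio b := fun x hx =>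
    lt_of_le_of_ne (le_csSup hbdd hx) fun he => hbJ (by rwa [hb, ← he])
  have htb : t₀ < b := hJb ht₀
  have hIco : Ico t₀ b ⊆ J := fun x hx => by
    obtain ⟨y, hy, hxy⟩ := exists_lt_of_lt_csSup ⟨t₀, ht₀⟩ hx.2
    exact h.Icc_subset ht₀ hy ⟨hx.1, hxy.le⟩
  have hge : ∀ x ∈ Ico t₀ b, ρ t₀ ≤ ρ x := fun x hx => h.le_of_pos ht₀ hpos (hIco hx) hx.1
  -- Gronwall's argument: `ρ` stays bounded up to the finite end point `b`, so by monotonicity it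
  -- has a positive limit there and could be continued, against maximality.
  have hanti : AntitoneOn (fun t => ρ t * Real.exp (-C * t)) (Ico t₀ b) := by
    have hder : ∀ x ∈ Ico t₀ b, HasDerivAt (fun t => ρ t * Real.exp (-C * t))
        (F (ρ x) * Real.exp (-C * x) + ρ x * (Real.exp (-C * x) * (-C))) x := fun x hx => by
      have h2 : HasDerivAt (fun t : ℝ => -C * t) (-C) x := by
        simpa using (hasDerivAt_id x).const_mul (-C)
      exact (h.hasDerivAt x (hIco hx)).mul h2.exp
    refine antitoneOn_of_deriv_nonpos (convex_Ico _ _)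
      (fun x hx => (hder x hx).continuousAt.continuousWithinAt)
      (fun x hx => (hder x (interior_subset hx)).differentiableAt.differentiableWithinAt) ?_
    intro x hx
    rw [(hder x (interior_subset hx)).deriv]
    have := hC _ (hge x (interior_subset hx))
    nlinarith [Real.exp_pos (-C * x)]
  have hmono : MonotoneOn ρ (Ioo t₀ b) := ((h.strictMonoOn ht₀ hpos).monotoneOn).mono
    fun x hx => ⟨hIco ⟨hx.1.le, hx.2⟩, hx.1.le⟩
  have hbd : BddAbove (ρ '' Ioo t₀ b) := by
    refine ⟨ρ t₀ * Real.exp (-C * t₀) * Real.exp (|C| * (|t₀| + |b|)), ?_⟩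
    rintro _ ⟨x, hx, rfl⟩
    have h1 := hanti ⟨le_rfl, htb⟩ ⟨hx.1.le, hx.2⟩ hx.1.le
    simp only at h1
    have h2 : C * x ≤ |C| * (|t₀| + |b|) := by
      have hx' : |x| ≤ |t₀| + |b| := by
        rw [abs_le]
        constructor
        · linarith [neg_abs_le t₀, abs_nonneg b, hx.1]
        · linarith [le_abs_self b, abs_nonneg t₀, hx.2]
      calc C * x ≤ |C * x| := le_abs_self _
        _ = |C| * |x| := abs_mul _ _
        _ ≤ _ := by gcongr
    calc ρ x = ρ x * Real.exp (-C * x) * Real.exp (C * x) := by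
          rw [mul_assoc, ← Real.exp_add]; simp
      _ ≤ _ := by
          have := h.pos t₀ ht₀
          gcongr
  have hne : (Ioo t₀ b).Nonempty := nonempty_Ioo.2 htb
  have hlim : Tendsto ρ (𝓝[<] b) (𝓝 (sSup (ρ '' Ioo t₀ b))) :=
    hmono.tendsto_nhdsWithin_Ioo_left hne hbd
  obtain ⟨x, hx⟩ := hne
  have hL : 0 < sSup (ρ '' Ioo t₀ b) :=
    (h.pos x (hIco ⟨hx.1.le, hx.2⟩)).trans_le (le_csSup hbd (mem_image_of_mem _ hx))
  obtain ⟨J', ρ', hs, hsub, hmem, heq⟩ := h.exists_extension hF hJb hIco htb hL hlim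
  rw [hmax J' ρ' hs hsub heq] at hmem
  exact hbJ hmem

end IsPositiveSolution

/-! ### Box dimension from two-sided volume bounds -/

/-- The quotients defining the contents lie between multiples of `ε ^ (s - d)`: they tend to `0` for
`s > d` and stay away from `0` for `s < d`. The value at `s = d` does not affect the infimum, and `d
> 0` makes the restriction `0 < s` harmless. -/
theorem hasBoxDim_of_volume_thickening_bounds {n : ℕ} {A : Set (EuclideanSpace ℝ (Fin n))}
    {d c C : ℝ} (hne : A.Nonempty) (hbd : Bornology.IsBounded A) (hd : 0 < d) (hc : 0 < c)
    (hlow : ∀ᶠ ε : ℝ in 𝓝[>] 0,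
      ENNReal.ofReal (c * ε ^ ((n : ℝ) - d)) ≤ volume (Metric.thickening ε A))
    (hup : ∀ᶠ ε : ℝ in 𝓝[>] 0,
      volume (Metric.thickening ε A) ≤ ENNReal.ofReal (C * ε ^ ((n : ℝ) - d))) :
    HasBoxDim A d := by
  have hquot : ∀ (K s ε : ℝ), 0 < ε → ENNReal.ofReal (K * ε ^ ((n : ℝ) - d)) /
      ENNReal.ofReal (ε ^ ((n : ℝ) - s)) = ENNReal.ofReal (K * ε ^ (s - d)) := by
    intro K s ε hε
    rw [← ENNReal.ofReal_div_of_pos (Real.rpow_pos_of_pos hε _), mul_div_assoc,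
      ← Real.rpow_sub hε]
    congr 3
    ring
  have hupper : ∀ s, d < s → upperMinkowskiContent s A = 0 := by
    intro s hs
    refine Tendsto.limsup_eq ?_
    have hlim : Tendsto (fun ε : ℝ => ENNReal.ofReal (C * ε ^ (s - d))) (𝓝[>] 0) (𝓝 0) := by
      have h1 : Tendsto (fun ε : ℝ => ε ^ (s - d)) (𝓝[>] 0) (𝓝 0) := by
        have := (Real.continuousAt_rpow_const 0 (s - d) (Or.inr (by linarith))).tendsto
        rw [Real.zero_rpow (by linarith)] at this
        exact this.mono_left nhdsWithin_le_nhds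
      simpa using ENNReal.tendsto_ofReal (h1.const_mul C)
    refine tendsto_of_tendsto_of_tendsto_of_le_of_le' tendsto_const_nhds hlim
      (Eventually.of_forall fun _ => zero_le) ?_
    filter_upwards [hup, self_mem_nhdsWithin] with ε h1 hε
    rw [← hquot C s ε hε]
    gcongr
  have hle : ∀ s, lowerMinkowskiContent s A ≤ upperMinkowskiContent s A := fun s =>
    liminf_le_limsup
  have hlower : ∀ s, lowerMinkowskiContent s A = 0 → d ≤ s := by
    intro s hs
    by_contra! hsd
    have : ENNReal.ofReal c ≤ lowerMinkowskiContent s A := by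
      refine le_liminf_of_le (by isBoundedDefault) ?_
      filter_upwards [hlow, self_mem_nhdsWithin, Ioo_mem_nhdsGT (zero_lt_one)] with ε h1 hε hε1
      calc ENNReal.ofReal c ≤ ENNReal.ofReal (c * ε ^ (s - d)) := by
            refine ENNReal.ofReal_le_ofReal (le_mul_of_one_le_right hc.le ?_)
            exact Real.one_le_rpow_of_pos_of_le_one_of_nonpos hε1.1 hε1.2.le (by linarith)
        _ = _ := (hquot c s ε hε).symm
        _ ≤ _ := by gcongr
    rw [hs] at this
    exact absurd this (not_le.2 (ENNReal.ofReal_pos.2 hc))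
  have hinf : ∀ T : Set ℝ, Ioi d ⊆ T → (∀ s ∈ T, d ≤ s) → sInf T = d := by
    intro T h1 h2
    refine le_antisymm (le_of_forall_gt_imp_ge_of_dense fun s hs => ?_)
      (le_csInf ⟨d + 1, h1 (by simp)⟩ h2)
    exact csInf_le ⟨d, h2⟩ (h1 hs)
  refine ⟨hne, hbd, hinf _ ?_ ?_, hinf _ ?_ ?_⟩
  · exact fun s hs => ⟨hd.trans hs, hupper s hs⟩
  · exact fun s hs => hlower s (le_antisymm ((hle s).trans hs.2.le) (zero_le))
  · exact fun s hs => ⟨hd.trans hs, le_antisymm ((hle s).trans (hupper s hs).le) (zero_le)⟩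
  · exact fun s hs => hlower s hs.2

/-! ### Points of the plane in polar coordinates -/

/-- The point of the plane with polar coordinates `(r, θ)`. -/
noncomputable def polarPoint (r θ : ℝ) : EuclideanSpace ℝ (Fin 2) := !₂[r * Real.cos θ, r * Real.sin θ]

theorem norm_polarPoint (r θ : ℝ) : ‖polarPoint r θ‖ = |r| := by
  rw [EuclideanSpace.norm_eq, Fin.sum_univ_two, ← Real.sqrt_sq_eq_abs]
  congr 1
  simp only [polarPoint, Real.norm_eq_abs, sq_abs, PiLp.toLp_apply, Matrix.cons_val_zero,
    Matrix.cons_val_one]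
  linear_combination r ^ 2 * Real.cos_sq_add_sin_sq θ

theorem polarPoint_sub_polarPoint (r r' θ : ℝ) :
    polarPoint r θ - polarPoint r' θ = polarPoint (r - r') θ := by
  ext i
  fin_cases i <;> simp [polarPoint] <;> ring

theorem dist_polarPoint_radius (r r' θ : ℝ) :
    dist (polarPoint r θ) (polarPoint r' θ) = |r - r'| := by
  rw [dist_eq_norm, polarPoint_sub_polarPoint, norm_polarPoint]

theorem dist_polarPoint_angle (r θ θ' : ℝ) :
    dist (polarPoint r θ) (polarPoint r θ') ≤ |r| * |θ - θ'| := by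
  have h : dist (polarPoint r θ) (polarPoint r θ') ^ 2 ≤ (|r| * |θ - θ'|) ^ 2 := by
    rw [EuclideanSpace.dist_eq, Real.sq_sqrt (by positivity), Fin.sum_univ_two]
    simp only [polarPoint, Real.dist_eq, sq_abs, PiLp.toLp_apply, Matrix.cons_val_zero,
      Matrix.cons_val_one, mul_pow]
    have h1 : (r * Real.cos θ - r * Real.cos θ') ^ 2 + (r * Real.sin θ - r * Real.sin θ') ^ 2 =
        r ^ 2 * (2 - 2 * Real.cos (θ - θ')) := by
      rw [Real.cos_sub]
      linear_combination r ^ 2 * (Real.cos_sq_add_sin_sq θ + Real.cos_sq_add_sin_sq θ')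
    rw [h1]
    have := Real.one_sub_sq_div_two_le_cos (x := θ - θ')
    gcongr
    linarith
  exact (pow_le_pow_iff_left₀ dist_nonneg (by positivity) two_ne_zero).1 h

theorem dist_polarPoint_le (r r' θ θ' : ℝ) :
    dist (polarPoint r θ) (polarPoint r' θ') ≤ |r - r'| + |r'| * |θ - θ'| :=
  (dist_triangle _ (polarPoint r' θ) _).trans
    (add_le_add (dist_polarPoint_radius r r' θ).le (dist_polarPoint_angle r' θ θ'))

theorem polarPoint_periodic (r θ : ℝ) (m : ℤ) :
    polarPoint r (θ + m * (2 * Real.pi)) = polarPoint r θ := by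
  simp [polarPoint, Real.cos_add_int_mul_two_pi, Real.sin_add_int_mul_two_pi]

theorem exists_eq_polarPoint (x : EuclideanSpace ℝ (Fin 2)) : ∃ θ, x = polarPoint ‖x‖ θ := by
  set z : ℂ := ⟨x 0, x 1⟩ with hz
  have hnorm : ‖z‖ = ‖x‖ := by
    rw [Complex.norm_eq_sqrt_sq_add_sq, EuclideanSpace.norm_eq, Fin.sum_univ_two]
    simp [hz]
  refine ⟨z.arg, ?_⟩
  ext i
  rw [← hnorm]
  fin_cases i <;> simp [polarPoint, hz]

theorem inversion_polarPoint {r : ℝ} (hr : 0 < r) (θ : ℝ) :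
    EuclideanGeometry.inversion (0 : EuclideanSpace ℝ (Fin 2)) 1 (polarPoint r θ) =
      polarPoint r⁻¹ θ := by
  rw [EuclideanGeometry.inversion, dist_zero_right, norm_polarPoint, abs_of_pos hr]
  ext i
  fin_cases i <;> simp [polarPoint] <;> field_simp

/-! ### Areas of neighbourhoods -/

theorem volume_ball_eq_ofReal (x : EuclideanSpace ℝ (Fin 2)) {r : ℝ} (hr : 0 ≤ r) :
    volume (Metric.ball x r) = ENNReal.ofReal (r ^ 2 * Real.pi) := by
  rw [EuclideanSpace.volume_ball_fin_two, ENNReal.ofReal_mul (by positivity),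
    ENNReal.ofReal_pow hr]

/-- About `K / ε + 1` equally spaced parameters give points such that the whole arc is within `ε` of
them; balls of radius `2ε` around these cover the neighbourhood. -/
theorem volume_thickening_image_Icc_le {γ : ℝ → EuclideanSpace ℝ (Fin 2)} {a K : ℝ} (hK : 0 ≤ K)
    (hγ : ∀ s ∈ Icc a (a + 1), ∀ t ∈ Icc a (a + 1), dist (γ s) (γ t) ≤ K * |s - t|)
    {ε : ℝ} (hε : 0 < ε) :
    volume (Metric.thickening ε (γ '' Icc a (a + 1))) ≤
      ENNReal.ofReal (4 * Real.pi * (K * ε + ε ^ 2)) := by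
  set m : ℕ := ⌊K / ε⌋₊ + 1 with hm
  have hm0 : (0 : ℝ) < m := by rw [hm]; positivity
  have hmK : K < m * ε := by
    rw [← div_lt_iff₀ hε, hm]; exact_mod_cast Nat.lt_floor_add_one _
  have hmle : (m : ℝ) ≤ K / ε + 1 := by
    rw [hm]; push_cast; gcongr; exact Nat.floor_le (by positivity)
  have hcover : Metric.thickening ε (γ '' Icc a (a + 1)) ⊆
      ⋃ i ∈ Finset.range m, Metric.ball (γ (a + i / m)) (2 * ε) := by
    intro x hx
    obtain ⟨_, ⟨s, hs, rfl⟩, hxs⟩ := Metric.mem_thickening_iff.1 hx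
    have hu0 : 0 ≤ (s - a) * m := mul_nonneg (by linarith [hs.1]) hm0.le
    obtain ⟨i, him, hi1, hi2⟩ : ∃ i < m, (i : ℝ) ≤ (s - a) * m ∧ (s - a) * m ≤ i + 1 := by
      rcases lt_or_ge ((s - a) * m) m with h | h
      · exact ⟨⌊(s - a) * m⌋₊, (Nat.floor_lt hu0).2 h, Nat.floor_le hu0,
          (Nat.lt_floor_add_one _).le⟩
      · have h2 : (s - a) * m ≤ 1 * m := by gcongr; linarith [hs.2]
        refine ⟨m - 1, by omega, ?_, ?_⟩ <;> rw [Nat.cast_sub (by omega)] <;> push_cast <;> linarith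
    have hi1' : (i : ℝ) / m ≤ s - a := by rwa [div_le_iff₀ hm0]
    have hi2' : s - a ≤ i / m + 1 / m := by rwa [← add_div, le_div_iff₀ hm0]
    refine mem_iUnion₂.2 ⟨i, Finset.mem_range.2 him, ?_⟩
    have hmem : a + (i : ℝ) / m ∈ Icc a (a + 1) := by
      refine ⟨by linarith [show (0 : ℝ) ≤ i / m by positivity], by linarith [hs.2]⟩
    have hd := hγ s hs _ hmem
    have habs : |s - (a + (i : ℝ) / m)| ≤ 1 / m := by
      rw [abs_le]; constructor <;> linarith [show (0 : ℝ) ≤ 1 / m by positivity]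
    have hd2 : K * |s - (a + (i : ℝ) / m)| ≤ ε := by
      calc K * |s - (a + (i : ℝ) / m)| ≤ (m * ε) * (1 / m) := by gcongr
        _ = ε := by field_simp
    rw [Metric.mem_ball]
    linarith [dist_triangle x (γ s) (γ (a + (i : ℝ) / m))]
  calc volume (Metric.thickening ε (γ '' Icc a (a + 1)))
      ≤ volume (⋃ i ∈ Finset.range m, Metric.ball (γ (a + i / m)) (2 * ε)) :=
        measure_mono hcover
    _ ≤ ∑ i ∈ Finset.range m, volume (Metric.ball (γ (a + i / m)) (2 * ε)) :=
        measure_biUnion_finset_le _ _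
    _ = ENNReal.ofReal (m * ((2 * ε) ^ 2 * Real.pi)) := by
        simp only [volume_ball_eq_ofReal _ (show 0 ≤ 2 * ε by positivity), Finset.sum_const,
          Finset.card_range, nsmul_eq_mul]
        rw [ENNReal.ofReal_mul (Nat.cast_nonneg m), ENNReal.ofReal_natCast]
    _ ≤ _ := by
        refine ENNReal.ofReal_le_ofReal ?_
        calc m * ((2 * ε) ^ 2 * Real.pi) ≤ (K / ε + 1) * ((2 * ε) ^ 2 * Real.pi) := by gcongr
          _ = _ := by field_simp; ring

/-- A set whose norms fill an interval of length `L` has an `ε`-neighbourhood of area at least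
`π L ε / 2`. -/
theorem le_volume_thickening_of_Icc_subset_norm {A : Set (EuclideanSpace ℝ (Fin 2))} {a b : ℝ}
    (hab : a ≤ b) (hA : Icc a b ⊆ norm '' A) {ε : ℝ} (hε : 0 < ε) :
    ENNReal.ofReal (Real.pi * (b - a) / 2 * ε) ≤ volume (Metric.thickening ε A) := by
  -- Points of `A` with norms `a + 2εi` are at least `2ε` apart by the reverse triangle inequality,
  -- so their `ε`-balls are disjoint. The `+ 1` counts both `i = 0` and the last admissible `i`.
  set m : ℕ := ⌊(b - a) / (2 * ε)⌋₊ + 1 with hm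
  have hx : ∀ i : ℕ, i < m → ∃ x ∈ A, ‖x‖ = a + i * (2 * ε) := by
    intro i hi
    have h1 : (i : ℝ) ≤ (b - a) / (2 * ε) :=
      (Nat.le_floor_iff (div_nonneg (by linarith) (by positivity))).1 (by omega)
    rw [le_div_iff₀ (by positivity)] at h1
    obtain ⟨x, hx, hxn⟩ := hA (show a + i * (2 * ε) ∈ Icc a b from
      ⟨by linarith [show 0 ≤ i * (2 * ε) by positivity], by linarith⟩)
    exact ⟨x, hx, hxn⟩
  choose! x hxA hxn using hx
  have hdisj : (Finset.range m : Set ℕ).PairwiseDisjoint fun i => Metric.ball (x i) ε := by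
    intro i hi j hj hij
    have hi' : i < m := by simpa using hi
    have hj' : j < m := by simpa using hj
    refine Metric.ball_disjoint_ball ?_
    have h1 := abs_norm_sub_norm_le (x i) (x j)
    rw [hxn i hi', hxn j hj', ← dist_eq_norm] at h1
    refine le_trans ?_ h1
    have h2 : (1 : ℝ) ≤ |(i : ℝ) - j| := by
      have : (1 : ℤ) ≤ |(i : ℤ) - j| := Int.one_le_abs (by omega)
      exact_mod_cast this
    rw [show a + i * (2 * ε) - (a + j * (2 * ε)) = ((i : ℝ) - j) * (2 * ε) by ring, abs_mul,
      abs_of_pos (show 0 < 2 * ε by positivity)]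
    nlinarith
  calc ENNReal.ofReal (Real.pi * (b - a) / 2 * ε) ≤ ENNReal.ofReal (m * (ε ^ 2 * Real.pi)) := by
        refine ENNReal.ofReal_le_ofReal ?_
        have h1 : (b - a) / (2 * ε) ≤ m := by
          rw [hm]; exact_mod_cast (Nat.lt_floor_add_one _).le
        calc Real.pi * (b - a) / 2 * ε = (b - a) / (2 * ε) * (ε ^ 2 * Real.pi) := by field_simp
          _ ≤ _ := by gcongr
    _ = ∑ i ∈ Finset.range m, volume (Metric.ball (x i) ε) := by
        simp only [volume_ball_eq_ofReal _ hε.le, Finset.sum_const, Finset.card_range,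
          nsmul_eq_mul]
        rw [ENNReal.ofReal_mul (Nat.cast_nonneg m), ENNReal.ofReal_natCast]
    _ = volume (⋃ i ∈ Finset.range m, Metric.ball (x i) ε) :=
        (measure_biUnion_finset hdisj fun _ _ => measurableSet_ball).symm
    _ ≤ _ := by
        refine measure_mono (iUnion₂_subset fun i hi => ?_)
        exact Metric.ball_subset_thickening (hxA i (Finset.mem_range.1 hi)) ε

/-! ### Areas of neighbourhoods of spirals -/

/-- The curve splits into a tail of `N` unit pieces, estimated by length, and a nucleus inside the
disc of radius `R`. -/
theorem volume_thickening_curve_le {γ : ℝ → EuclideanSpace ℝ (Fin 2)} {K : ℕ → ℝ}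
    (hK : ∀ n, 0 ≤ K n)
    (hγ : ∀ n : ℕ, ∀ s ∈ Icc (1 + n : ℝ) (1 + n + 1), ∀ t ∈ Icc (1 + n : ℝ) (1 + n + 1),
      dist (γ s) (γ t) ≤ K n * |s - t|)
    {N : ℕ} {R : ℝ} (hR : ∀ s, 1 + (N : ℝ) ≤ s → ‖γ s‖ ≤ R) {ε : ℝ} (hε : 0 < ε) :
    volume (Metric.thickening ε (γ '' Ici 1)) ≤ ENNReal.ofReal
      (4 * Real.pi * (ε * ∑ n ∈ Finset.range N, K n + N * ε ^ 2) + (R + ε) ^ 2 * Real.pi) := by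
  have hR0 : 0 ≤ R := (norm_nonneg _).trans (hR _ le_rfl)
  have hsub : Metric.thickening ε (γ '' Ici 1) ⊆
      (⋃ n ∈ Finset.range N, Metric.thickening ε (γ '' Icc (1 + n : ℝ) (1 + n + 1))) ∪
        Metric.ball 0 (R + ε) := by
    intro x hx
    obtain ⟨_, ⟨s, hs, rfl⟩, hxs⟩ := Metric.mem_thickening_iff.1 hx
    have hs1 : (1 : ℝ) ≤ s := hs
    rcases lt_or_ge s (1 + N) with h | h
    · left
      have h0 : 0 ≤ s - 1 := by linarith
      refine mem_iUnion₂.2 ⟨⌊s - 1⌋₊, Finset.mem_range.2 ((Nat.floor_lt h0).2 (by linarith)),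
        Metric.mem_thickening_iff.2 ⟨γ s, mem_image_of_mem _ ⟨?_, ?_⟩, hxs⟩⟩
      · linarith [Nat.floor_le h0]
      · linarith [(Nat.lt_floor_add_one (s - 1)).le]
    · right
      rw [Metric.mem_ball]
      have h1 : dist (γ s) 0 ≤ R := by rw [dist_zero_right]; exact hR s h
      linarith [dist_triangle x (γ s) 0]
  have hnn : ∀ n ∈ Finset.range N, 0 ≤ 4 * Real.pi * (K n * ε + ε ^ 2) := fun n _ => by
    have := hK n
    positivity
  calc volume (Metric.thickening ε (γ '' Ici 1))
      ≤ volume (⋃ n ∈ Finset.range N, Metric.thickening ε (γ '' Icc (1 + n : ℝ) (1 + n + 1))) +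
          volume (Metric.ball (0 : EuclideanSpace ℝ (Fin 2)) (R + ε)) :=
        (measure_mono hsub).trans (measure_union_le _ _)
    _ ≤ ∑ n ∈ Finset.range N, ENNReal.ofReal (4 * Real.pi * (K n * ε + ε ^ 2)) +
          ENNReal.ofReal ((R + ε) ^ 2 * Real.pi) := by
        refine add_le_add ((measure_biUnion_finset_le _ _).trans (Finset.sum_le_sum fun n _ => ?_))
          (volume_ball_eq_ofReal _ (by linarith)).le
        exact volume_thickening_image_Icc_le (hK n) (hγ n) hε
    _ = _ := by
        rw [← ENNReal.ofReal_sum_of_nonneg hnn, ← ENNReal.ofReal_add (Finset.sum_nonneg hnn)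
          (by positivity)]
        congr 2
        rw [← Finset.mul_sum, Finset.sum_add_distrib, ← Finset.sum_mul, Finset.sum_const,
          Finset.card_range, nsmul_eq_mul, mul_comm ε]

theorem exists_volume_thickening_curve_le {γ : ℝ → EuclideanSpace ℝ (Fin 2)} {K : ℕ → ℝ}
    (hK : ∀ n, 0 ≤ K n)
    (hγ : ∀ n : ℕ, ∀ s ∈ Icc (1 + n : ℝ) (1 + n + 1), ∀ t ∈ Icc (1 + n : ℝ) (1 + n + 1),
      dist (γ s) (γ t) ≤ K n * |s - t|)
    {α C : ℝ} (hα0 : 0 < α) (hα1 : α ≤ 1) (hC : 0 ≤ C)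
    (hsum : ∀ N : ℕ, 1 ≤ N → ∑ n ∈ Finset.range N, K n ≤ C * (N : ℝ) ^ (1 - α))
    (hnorm : ∀ N : ℕ, 1 ≤ N → ∀ s, 1 + (N : ℝ) ≤ s → ‖γ s‖ ≤ C * (N : ℝ) ^ (-α)) :
    ∃ C' : ℝ, ∀ ε ∈ Ioo (0 : ℝ) 1, volume (Metric.thickening ε (γ '' Ici 1)) ≤
      ENNReal.ofReal (C' * ε ^ (2 - 2 / (1 + α))) := by
  refine ⟨4 * Real.pi * (2 * C + 2) + (C + 1) ^ 2 * Real.pi, ?_⟩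
  rintro ε ⟨hε0, hε1⟩
  -- The cut `N ≈ ε ^ (-q)` balances the tail `ε * N ^ (1 - α)` against the nucleus `N ^ (-2 * α)`.
  set q := 1 / (1 + α) with hq
  have hq0 : 0 < q := by positivity
  have hqα : q * (1 + α) = 1 := by rw [hq]; field_simp
  have he : 2 - 2 / (1 + α) = 2 * (q * α) := by
    rw [hq]; field_simp; ring
  set x := ε ^ (-q) with hx
  have hx1 : 1 ≤ x := Real.one_le_rpow_of_pos_of_le_one_of_nonpos hε0 hε1.le (by linarith)
  set N := ⌈x⌉₊ with hN
  have hxN : x ≤ N := Nat.le_ceil x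
  have hN1 : 1 ≤ N := by
    have : (1 : ℝ) ≤ N := hx1.trans hxN
    exact_mod_cast this
  have hN2 : (N : ℝ) ≤ 2 * x := by linarith [Nat.ceil_lt_add_one (show 0 ≤ x by linarith)]
  have hNα : (N : ℝ) ^ (-α) ≤ ε ^ (q * α) := by
    calc (N : ℝ) ^ (-α) ≤ x ^ (-α) :=
          Real.rpow_le_rpow_of_nonpos (by linarith) hxN (by linarith)
      _ = ε ^ (q * α) := by rw [hx, ← Real.rpow_mul hε0.le]; congr 1; ring
  have hε' : ε ≤ ε ^ (q * α) := by
    conv_lhs => rw [← Real.rpow_one ε]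
    exact Real.rpow_le_rpow_of_exponent_ge hε0 hε1.le (by nlinarith)
  have hN1α : ε * (N : ℝ) ^ (1 - α) ≤ 2 * ε ^ (2 * (q * α)) := by
    calc ε * (N : ℝ) ^ (1 - α) ≤ ε * (2 * x) ^ (1 - α) := by
          gcongr
      _ = ε * (2 ^ (1 - α) * x ^ (1 - α)) := by
          rw [Real.mul_rpow zero_le_two (by linarith)]
      _ ≤ ε * (2 * x ^ (1 - α)) := by
          gcongr
          conv_rhs => rw [← Real.rpow_one (2 : ℝ)]
          exact Real.rpow_le_rpow_of_exponent_le one_le_two (by linarith)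
      _ = 2 * (ε ^ (1 : ℝ) * ε ^ (-q * (1 - α))) := by
          rw [hx, ← Real.rpow_mul hε0.le, Real.rpow_one]; ring
      _ = 2 * ε ^ (2 * (q * α)) := by
          rw [← Real.rpow_add hε0]
          congr 2
          linear_combination -hqα
  have hNε : N * ε ^ 2 ≤ 2 * ε ^ (2 * (q * α)) := by
    calc N * ε ^ 2 ≤ (2 * x) * ε ^ 2 := by gcongr
      _ = 2 * (ε ^ (-q) * ε ^ (2 : ℝ)) := by rw [hx, Real.rpow_two]; ring
      _ = 2 * ε ^ (-q + 2) := by rw [← Real.rpow_add hε0]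
      _ ≤ 2 * ε ^ (2 * (q * α)) := by
          have := Real.rpow_le_rpow_of_exponent_ge hε0 hε1.le
            (show 2 * (q * α) ≤ -q + 2 by nlinarith)
          gcongr
  refine (volume_thickening_curve_le hK hγ (hnorm N hN1) hε0).trans (ENNReal.ofReal_le_ofReal ?_)
  rw [he]
  have hR : (C * (N : ℝ) ^ (-α) + ε) ^ 2 ≤ (C + 1) ^ 2 * ε ^ (2 * (q * α)) := by
    calc (C * (N : ℝ) ^ (-α) + ε) ^ 2 ≤ (C * ε ^ (q * α) + ε ^ (q * α)) ^ 2 := by gcongr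
      _ = (C + 1) ^ 2 * ε ^ (2 * (q * α)) := by
          rw [two_mul, Real.rpow_add hε0]; ring
  have hS : ε * ∑ n ∈ Finset.range N, K n ≤ C * (2 * ε ^ (2 * (q * α))) := by
    calc ε * ∑ n ∈ Finset.range N, K n ≤ ε * (C * (N : ℝ) ^ (1 - α)) := by
          gcongr; exact hsum N hN1
      _ = C * (ε * (N : ℝ) ^ (1 - α)) := by ring
      _ ≤ _ := by gcongr
  calc _ ≤ 4 * Real.pi * (C * (2 * ε ^ (2 * (q * α))) + 2 * ε ^ (2 * (q * α))) +
        (C + 1) ^ 2 * ε ^ (2 * (q * α)) * Real.pi := by gcongr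
    _ = _ := by ring

/-- Upper bound for the area of a neighbourhood of a spiral. -/
theorem exists_volume_thickening_spiral_le {r : ℝ → ℝ} {σ θ₀ D α C : ℝ} (hσ : |σ| = 1)
    (hr : ∀ s, 1 ≤ s → 0 < r s) (hanti : AntitoneOn r (Ici 1)) (hD : 0 ≤ D)
    (hlip : ∀ t s, 1 ≤ t → t ≤ s → r t - r s ≤ D * r t * (s - t))
    (hα0 : 0 < α) (hα1 : α ≤ 1) (hC : 0 ≤ C)
    (hsum : ∀ N : ℕ, 1 ≤ N → ∑ n ∈ Finset.range N, r (1 + n) ≤ C * (N : ℝ) ^ (1 - α)) :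
    ∃ C' : ℝ, ∀ ε ∈ Ioo (0 : ℝ) 1, volume (Metric.thickening ε
      ((fun s => polarPoint (r s) (σ * s + θ₀)) '' Ici 1)) ≤
      ENNReal.ofReal (C' * ε ^ (2 - 2 / (1 + α))) := by
  have h1n : ∀ n : ℕ, (1 : ℝ) ≤ 1 + n := fun n => by simp
  have hlip' : ∀ t s, 1 ≤ t → 1 ≤ s → ∀ n : ℕ, 1 + (n : ℝ) ≤ t → 1 + (n : ℝ) ≤ s →
      |r s - r t| ≤ D * r (1 + n) * |s - t| := by
    have key : ∀ t s, 1 ≤ t → t ≤ s → ∀ n : ℕ, 1 + (n : ℝ) ≤ t →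
        |r s - r t| ≤ D * r (1 + n) * |s - t| := by
      intro t s ht hts n hn
      rw [abs_of_nonneg (sub_nonneg.2 hts), abs_sub_comm,
        abs_of_nonneg (sub_nonneg.2 (hanti ht (ht.trans hts) hts))]
      refine (hlip t s ht hts).trans ?_
      have := hanti (h1n n) ht hn
      have := sub_nonneg.2 hts
      gcongr
    intro t s ht hs n hnt hns
    rcases le_total t s with h | h
    · exact key t s ht h n hnt
    · rw [abs_sub_comm, abs_sub_comm s t]
      exact key s t hs h n hns
  refine exists_volume_thickening_curve_le (K := fun n => (D + 1) * r (1 + n)) (C := (D + 1) * C)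
    (fun n => mul_nonneg (by linarith) (hr _ (h1n n)).le) ?_ hα0 hα1 (by positivity) ?_ ?_
  · intro n s hs t ht
    have hs1 : 1 ≤ s := (h1n n).trans hs.1
    have ht1 : 1 ≤ t := (h1n n).trans ht.1
    refine (dist_polarPoint_le _ _ _ _).trans ?_
    rw [show σ * s + θ₀ - (σ * t + θ₀) = σ * (s - t) by ring, abs_mul, hσ, one_mul,
      abs_of_pos (hr t ht1)]
    have h1 := hlip' t s ht1 hs1 n ht.1 hs.1
    have h2 := hanti (h1n n) ht1 ht.1
    have h3 : r t * |s - t| ≤ r (1 + n) * |s - t| := by gcongr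
    linarith
  · intro N hN
    rw [← Finset.mul_sum, mul_assoc]
    have := hsum N hN
    gcongr
  · intro N hN s hs
    have hs1 : 1 ≤ s := (h1n N).trans hs
    rw [norm_polarPoint, abs_of_pos (hr s hs1), mul_assoc]
    have h1 := hanti (h1n N) hs1 hs
    have hN0 : (0 : ℝ) < N := by exact_mod_cast hN
    have h2 : r (1 + N) ≤ C * (N : ℝ) ^ (-α) := by
      -- As `r` decreases, each of the `N` summands is at least `r (1 + N)`; thus the bound on sums
      -- already contains the pointwise one.
      have h3 : N * r (1 + N) ≤ C * (N : ℝ) ^ (1 - α) := by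
        refine le_trans ?_ (hsum N hN)
        have h4 := Finset.card_nsmul_le_sum (Finset.range N) (fun n : ℕ => r (1 + n)) (r (1 + N))
        rw [Finset.card_range, nsmul_eq_mul] at h4
        refine h4 fun n hn => hanti (h1n n) (h1n N) ?_
        have : (n : ℝ) ≤ N := by exact_mod_cast (Finset.mem_range.1 hn).le
        linarith
      rw [sub_eq_add_neg, Real.rpow_add hN0, Real.rpow_one] at h3
      refine le_of_mul_le_mul_left ?_ hN0
      linarith
    nlinarith [hr s hs1]

/-- The nucleus of the neighbourhood of a spiral is a full disc. -/
theorem ball_subset_thickening_spiral {r : ℝ → ℝ} {σ θ₀ ε s₀ : ℝ} (hσ : |σ| = 1) (hε : 0 < ε)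
    (hr : ∀ s, s₀ ≤ s → 0 < r s) (hcont : ContinuousOn r (Ici s₀))
    (hlim : Tendsto r atTop (𝓝 0))
    (hlip : ∀ t s, s₀ ≤ t → t ≤ s → s ≤ t + 2 * Real.pi → |r t - r s| < ε) :
    Metric.ball 0 (r s₀) ⊆
      Metric.thickening ε ((fun s => polarPoint (r s) (σ * s + θ₀)) '' Ici s₀) := by
  intro x hx
  rw [mem_ball_zero_iff] at hx
  rw [Metric.mem_thickening_iff]
  rcases (norm_nonneg x).eq_or_lt with h0 | h0
  · obtain ⟨s, hs, hsε⟩ := ((eventually_ge_atTop s₀).and (hlim.eventually (gt_mem_nhds hε))).exists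
    refine ⟨_, mem_image_of_mem _ hs, ?_⟩
    rw [norm_eq_zero.1 h0.symm, dist_zero_left, norm_polarPoint, abs_of_pos (hr s hs)]
    exact hsε
  obtain ⟨s₁, hs₁, hs₁x⟩ := ((eventually_ge_atTop s₀).and
    (hlim.eventually (gt_mem_nhds h0))).exists
  obtain ⟨t, ht, htx⟩ := intermediate_value_Icc' hs₁
    (hcont.mono Icc_subset_Ici_self) ⟨hs₁x.le, hx.le⟩
  obtain ⟨θ, hθ⟩ := exists_eq_polarPoint x
  have hσ2 : σ * σ = 1 := by rw [← abs_mul_abs_self, hσ, one_mul]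
  -- With `r t = ‖x‖`, pick the parameter in `[t, t + 2π)` at which the spiral crosses the ray
  -- through `x`. The distance is then purely radial and is controlled by the gap of one turn.
  obtain ⟨m, hm, -⟩ := existsUnique_add_zsmul_mem_Ico Real.two_pi_pos (σ * (θ - θ₀)) t
  set s := σ * (θ - θ₀) + m • (2 * Real.pi) with hs
  have hs0 : s₀ ≤ s := ht.1.trans hm.1
  refine ⟨_, mem_image_of_mem _ hs0, ?_⟩
  have hang : ∃ m' : ℤ, σ * s + θ₀ = θ + m' * (2 * Real.pi) := by
    rcases eq_or_eq_neg_of_abs_eq hσ with h | h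
    · exact ⟨m, by rw [hs, h, zsmul_eq_mul]; ring⟩
    · exact ⟨-m, by rw [hs, h, zsmul_eq_mul]; push_cast; ring⟩
  obtain ⟨m', hm'⟩ := hang
  have hxe : x = polarPoint (r t) θ := by rw [htx]; exact hθ
  simp only [hm', polarPoint_periodic]
  rw [hxe, dist_polarPoint_radius]
  exact hlip t s ht.1 hm.1 hm.2.le

/-- From `s₀ = B * ε ^ (-1/(1 + α))` on, the radius drops by less than `ε` per turn, so the
neighbourhood contains the disc of radius `r s₀`. The constant `B` exceeds `2πD` to make the
inequality strict. -/
theorem exists_le_volume_thickening_spiral {r : ℝ → ℝ} {σ θ₀ D α c : ℝ} (hσ : |σ| = 1)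
    (hr : ∀ s, 1 ≤ s → 0 < r s) (hcont : ContinuousOn r (Ici 1)) (hlim : Tendsto r atTop (𝓝 0))
    (hα0 : 0 < α) (hD : 0 ≤ D)
    (hlip : ∀ t s, 1 ≤ t → t ≤ s → |r t - r s| ≤ D * t ^ (-(1 + α)) * (s - t))
    (hc : 0 < c) (hpt : ∀ s, 1 ≤ s → c * s ^ (-α) ≤ r s) :
    ∃ c' > 0, ∀ ε ∈ Ioo (0 : ℝ) 1, ENNReal.ofReal (c' * ε ^ (2 - 2 / (1 + α))) ≤
      volume (Metric.thickening ε ((fun s => polarPoint (r s) (σ * s + θ₀)) '' Ici 1)) := by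
  set B : ℝ := D * (2 * Real.pi) + 1 with hB
  have hπ := Real.pi_pos
  have hB1 : 1 ≤ B := by rw [hB]; linarith [show 0 ≤ D * (2 * Real.pi) by positivity]
  have hB0 : 0 < B := by linarith
  refine ⟨(c * B ^ (-α)) ^ 2 * Real.pi, by positivity, ?_⟩
  rintro ε ⟨hε0, hε1⟩
  set q := 1 / (1 + α) with hq
  have hq0 : 0 < q := by positivity
  have hqα : q * (1 + α) = 1 := by rw [hq]; field_simp
  have he : 2 - 2 / (1 + α) = 2 * (q * α) := by
    rw [hq]; field_simp; ring
  have hx1 : 1 ≤ ε ^ (-q) :=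
    Real.one_le_rpow_of_pos_of_le_one_of_nonpos hε0 hε1.le (by linarith)
  set s₀ := B * ε ^ (-q) with hs₀
  have hs₀1 : 1 ≤ s₀ := one_le_mul_of_one_le_of_one_le hB1 hx1
  have hsmall : D * s₀ ^ (-(1 + α)) * (2 * Real.pi) < ε := by
    have h1 : s₀ ^ (-(1 + α)) ≤ B⁻¹ * ε := by
      rw [hs₀, Real.mul_rpow hB0.le (by positivity), ← Real.rpow_mul hε0.le,
        show -q * -(1 + α) = 1 by linarith, Real.rpow_one]
      gcongr
      rw [← Real.rpow_neg_one]
      exact Real.rpow_le_rpow_of_exponent_le hB1 (by linarith)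
    calc D * s₀ ^ (-(1 + α)) * (2 * Real.pi) ≤ D * (B⁻¹ * ε) * (2 * Real.pi) := by gcongr
      _ = (D * (2 * Real.pi)) / B * ε := by ring
      _ < 1 * ε := by
          gcongr
          rw [div_lt_one hB0]; linarith
      _ = ε := one_mul ε
  have hball := ball_subset_thickening_spiral (θ₀ := θ₀) hσ hε0 (fun s hs => hr s (hs₀1.trans hs))
    (hcont.mono (Ici_subset_Ici.2 hs₀1)) hlim (s₀ := s₀) (fun t s ht hts hs => by
      refine (hlip t s (hs₀1.trans ht) hts).trans_lt (lt_of_le_of_lt ?_ hsmall)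
      have h1 : t ^ (-(1 + α)) ≤ s₀ ^ (-(1 + α)) :=
        Real.rpow_le_rpow_of_nonpos (by linarith) ht (by linarith)
      have h2 : s - t ≤ 2 * Real.pi := by linarith
      have h3 : 0 ≤ s - t := by linarith
      gcongr)
  refine le_trans ?_ ((measure_mono hball).trans
    (measure_mono (Metric.thickening_subset_of_subset ε (image_mono (Ici_subset_Ici.2 hs₀1)))))
  rw [volume_ball_eq_ofReal _ (hr s₀ hs₀1).le]
  refine ENNReal.ofReal_le_ofReal ?_
  have h2 : c * B ^ (-α) * ε ^ (q * α) ≤ r s₀ := by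
    refine le_trans (le_of_eq ?_) (hpt s₀ hs₀1)
    rw [hs₀, Real.mul_rpow hB0.le (by positivity), ← Real.rpow_mul hε0.le]
    ring_nf
  calc (c * B ^ (-α)) ^ 2 * Real.pi * ε ^ (2 - 2 / (1 + α))
      = (c * B ^ (-α) * ε ^ (q * α)) ^ 2 * Real.pi := by
        rw [he, two_mul, Real.rpow_add hε0]; ring
    _ ≤ r s₀ ^ 2 * Real.pi := by gcongr

/-! ### Growth of solutions of `u' = κ u ^ (1 - 2k) + O(u ^ (-1 - 2k))` -/

theorem mul_sub_le_image_sub_of_hasDerivAt {f f' : ℝ → ℝ} {t s a : ℝ} (hts : t ≤ s)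
    (hf : ∀ x ∈ Icc t s, HasDerivAt f (f' x) x) (ha : ∀ x ∈ Icc t s, a ≤ f' x) :
    a * (s - t) ≤ f s - f t := by
  refine (convex_Icc t s).mul_sub_le_image_sub_of_le_deriv
    (fun x hx => (hf x hx).continuousAt.continuousWithinAt)
    (fun x hx => (hf x (interior_subset hx)).differentiableAt.differentiableWithinAt)
    (fun x hx => ?_) t ⟨le_rfl, hts⟩ s ⟨hts, le_rfl⟩ hts
  rw [(hf x (interior_subset hx)).deriv]
  exact ha x (interior_subset hx)

theorem image_sub_le_mul_sub_of_hasDerivAt {f f' : ℝ → ℝ} {t s a : ℝ} (hts : t ≤ s)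
    (hf : ∀ x ∈ Icc t s, HasDerivAt f (f' x) x) (ha : ∀ x ∈ Icc t s, f' x ≤ a) :
    f s - f t ≤ a * (s - t) := by
  have := mul_sub_le_image_sub_of_hasDerivAt (f := fun x => -f x) (f' := fun x => -f' x) (a := -a)
    hts (fun x hx => (hf x hx).neg) (fun x hx => neg_le_neg (ha x hx))
  linarith

theorem sum_rpow_neg_le {α : ℝ} (hα0 : 0 ≤ α) (hα1 : α < 1) (N : ℕ) :
    ∑ n ∈ Finset.range N, (1 + (n : ℝ)) ^ (-α) ≤ (N : ℝ) ^ (1 - α) / (1 - α) := by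
  have h1α : 0 < 1 - α := by linarith
  induction N with
  | zero => simp [Real.zero_rpow h1α.ne']
  | succ n ih =>
    rw [Finset.sum_range_succ]
    have hn : (0 : ℝ) < 1 + n := by positivity
    -- Bernoulli's inequality for an exponent in `[0, 1]`, i.e. the tangent at `1 + n` lies above
    -- the concave power; it makes the sum telescope.
    have h1 : (n : ℝ) ^ (1 - α) ≤ (1 + n : ℝ) ^ (1 - α) - (1 - α) * (1 + n : ℝ) ^ (-α) := by
      have hs : -1 ≤ -(1 + n : ℝ)⁻¹ :=
        neg_le_neg (inv_le_one_of_one_le₀ (by linarith [show (0 : ℝ) ≤ n by positivity]))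
      have h2 := rpow_one_add_le_one_add_mul_self hs h1α.le (by linarith : 1 - α ≤ 1)
      have h3 : (n : ℝ) = (1 + n) * (1 + -(1 + n : ℝ)⁻¹) := by field_simp; ring
      calc (n : ℝ) ^ (1 - α) = ((1 + n) * (1 + -(1 + n : ℝ)⁻¹)) ^ (1 - α) := by rw [← h3]
        _ = (1 + n : ℝ) ^ (1 - α) * (1 + -(1 + n : ℝ)⁻¹) ^ (1 - α) :=
            Real.mul_rpow hn.le (by linarith)
        _ ≤ (1 + n : ℝ) ^ (1 - α) * (1 + (1 - α) * -(1 + n : ℝ)⁻¹) := by gcongr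
        _ = _ := by
            rw [show -α = (1 - α) - 1 by ring, Real.rpow_sub_one hn.ne']
            ring
    calc _ ≤ (n : ℝ) ^ (1 - α) / (1 - α) + (1 + (n : ℝ)) ^ (-α) := by gcongr
      _ ≤ ((1 + n : ℝ) ^ (1 - α) - (1 - α) * (1 + n : ℝ) ^ (-α)) / (1 - α) +
          (1 + (n : ℝ)) ^ (-α) := by gcongr
      _ = ((n + 1 : ℕ) : ℝ) ^ (1 - α) / (1 - α) := by
          push_cast
          rw [add_comm (n : ℝ) 1]
          field_simp
          ring

/-- `u` is positive on `[1, ∞)` and `u' = κ u ^ (1 - 2k) + O(u ^ (-1 - 2k))`, where `u'` is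
positive and of the exact order `u ^ (1 - 2k)`. -/
structure SpiralGrowth (k : ℕ) (κ : ℝ) (u : ℝ → ℝ) : Prop where
  pos : ∀ s, 1 ≤ s → 0 < u s
  rate_pos : 0 < κ
  exists_deriv : ∃ (v : ℝ → ℝ) (c₁ c₂ C : ℝ), 0 < c₁ ∧ ∀ s, 1 ≤ s → HasDerivAt u (v s) s ∧
    c₁ * u s ≤ v s * u s ^ (2 * k) ∧ v s * u s ^ (2 * k) ≤ c₂ * u s ∧
    |v s * u s ^ (2 * k) - κ * u s| ≤ C / u s

namespace SpiralGrowth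

variable {k : ℕ} {κ : ℝ} {u : ℝ → ℝ}

theorem strictMonoOn (h : SpiralGrowth k κ u) : StrictMonoOn u (Ici 1) := by
  obtain ⟨v, c₁, c₂, C, hc₁, hv⟩ := h.exists_deriv
  refine strictMonoOn_of_deriv_pos (convex_Ici 1)
    (fun x hx => (hv x hx).1.continuousAt.continuousWithinAt) fun x hx => ?_
  have hx1 : 1 ≤ x := interior_subset hx
  rw [(hv x hx1).1.deriv]
  have hu := h.pos x hx1
  exact pos_of_mul_pos_left ((mul_pos hc₁ hu).trans_le (hv x hx1).2.1) (by positivity)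

theorem antitoneOn_inv (h : SpiralGrowth k κ u) : AntitoneOn (fun s => (u s)⁻¹) (Ici 1) :=
  fun s hs _ ht hst => inv_anti₀ (h.pos s hs) (h.strictMonoOn.monotoneOn hs ht hst)

theorem continuousOn_inv (h : SpiralGrowth k κ u) : ContinuousOn (fun s => (u s)⁻¹) (Ici 1) := by
  obtain ⟨v, c₁, c₂, C, hc₁, hv⟩ := h.exists_deriv
  exact ContinuousOn.inv₀ (fun x hx => (hv x hx).1.continuousAt.continuousWithinAt)
    fun x hx => (h.pos x hx).ne'

/-- The derivative `-v / u ^ 2` of `1 / u` is at least `-c₂ * u⁻¹ ^ (2k + 1)`, and `1 / u`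
decreases, so its value at `t` dominates on `[t, s]`. -/
theorem exists_inv_sub_inv_le (h : SpiralGrowth k κ u) : ∃ c ≥ 0, ∀ t s, 1 ≤ t → t ≤ s →
    (u t)⁻¹ - (u s)⁻¹ ≤ c * (u t)⁻¹ ^ (2 * k + 1) * (s - t) := by
  obtain ⟨v, c₁, c₂, C, hc₁, hv⟩ := h.exists_deriv
  have hc₂ : 0 ≤ c₂ := by
    have h1 := (hv 1 le_rfl).2.1.trans (hv 1 le_rfl).2.2.1
    exact hc₁.le.trans (le_of_mul_le_mul_right h1 (h.pos 1 le_rfl))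
  refine ⟨c₂, hc₂, fun t s ht hts => ?_⟩
  have := mul_sub_le_image_sub_of_hasDerivAt (f := fun x => (u x)⁻¹)
    (f' := fun x => -v x / u x ^ 2) (a := -(c₂ * (u t)⁻¹ ^ (2 * k + 1))) hts
    (fun x hx => (hv x (ht.trans hx.1)).1.inv (h.pos x (ht.trans hx.1)).ne') ?_
  · linarith
  · intro x hx
    have hx1 := ht.trans hx.1
    have hu := h.pos x hx1
    rw [neg_div]
    refine neg_le_neg ?_
    calc v x / u x ^ 2 = (v x * u x ^ (2 * k)) * ((u x)⁻¹ ^ (2 * k) * (u x)⁻¹ ^ 2) := by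
          simp only [inv_pow]; field_simp
      _ ≤ (c₂ * u x) * ((u x)⁻¹ ^ (2 * k) * (u x)⁻¹ ^ 2) :=
          mul_le_mul_of_nonneg_right (hv x hx1).2.2.1 (by positivity)
      _ = c₂ * (u x)⁻¹ ^ (2 * k + 1) := by simp only [inv_pow, pow_succ]; field_simp
      _ ≤ c₂ * (u t)⁻¹ ^ (2 * k + 1) := by
          have := h.antitoneOn_inv ht hx1 hx.1
          simp only at this
          gcongr

theorem exists_volume_le (h : SpiralGrowth k κ u) {σ θ₀ α C : ℝ} (hσ : |σ| = 1)
    (hα0 : 0 < α) (hα1 : α ≤ 1) (hC : 0 ≤ C)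
    (hsum : ∀ N : ℕ, 1 ≤ N → ∑ n ∈ Finset.range N, (u (1 + n))⁻¹ ≤ C * (N : ℝ) ^ (1 - α)) :
    ∃ C' : ℝ, ∀ ε ∈ Ioo (0 : ℝ) 1, volume (Metric.thickening ε
      ((fun s => polarPoint (u s)⁻¹ (σ * s + θ₀)) '' Ici 1)) ≤
      ENNReal.ofReal (C' * ε ^ (2 - 2 / (1 + α))) := by
  obtain ⟨c, hc, hlip⟩ := h.exists_inv_sub_inv_le
  have hu1 := h.pos 1 le_rfl
  refine exists_volume_thickening_spiral_le (D := c * (u 1)⁻¹ ^ (2 * k)) hσ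
    (fun s hs => inv_pos.2 (h.pos s hs)) h.antitoneOn_inv (by positivity) ?_ hα0 hα1 hC hsum
  intro t s ht hts
  refine (hlip t s ht hts).trans ?_
  have h1 := h.antitoneOn_inv (mem_Ici.2 le_rfl) ht ht
  have h2 := h.pos t ht
  have h3 : 0 ≤ s - t := sub_nonneg.2 hts
  simp only at h1
  rw [pow_succ, ← mul_assoc]
  gcongr

theorem isBounded (h : SpiralGrowth k κ u) (σ θ₀ : ℝ) :
    Bornology.IsBounded ((fun s => polarPoint (u s)⁻¹ (σ * s + θ₀)) '' Ici 1) := by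
  refine (Metric.isBounded_closedBall (x := 0) (r := (u 1)⁻¹)).subset ?_
  rintro _ ⟨s, hs, rfl⟩
  rw [mem_closedBall_zero_iff, norm_polarPoint, abs_of_pos (inv_pos.2 (h.pos s hs))]
  exact h.antitoneOn_inv (mem_Ici.2 le_rfl) hs hs

theorem hasBoxDim_of_volume (h : SpiralGrowth k κ u) {σ θ₀ α c C : ℝ} (hα : 0 < α) (hc : 0 < c)
    (hlow : ∀ ε ∈ Ioo (0 : ℝ) 1, ENNReal.ofReal (c * ε ^ (2 - 2 / (1 + α))) ≤
      volume (Metric.thickening ε ((fun s => polarPoint (u s)⁻¹ (σ * s + θ₀)) '' Ici 1)))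
    (hup : ∀ ε ∈ Ioo (0 : ℝ) 1, volume (Metric.thickening ε
      ((fun s => polarPoint (u s)⁻¹ (σ * s + θ₀)) '' Ici 1)) ≤
      ENNReal.ofReal (C * ε ^ (2 - 2 / (1 + α)))) :
    HasBoxDim ((fun s => polarPoint (u s)⁻¹ (σ * s + θ₀)) '' Ici 1) (2 / (1 + α)) := by
  refine hasBoxDim_of_volume_thickening_bounds (c := c) (C := C) (nonempty_Ici.image _)
    (h.isBounded σ θ₀) (by positivity) hc ?_ ?_
  · filter_upwards [Ioo_mem_nhdsGT zero_lt_one] with ε hε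
    exact_mod_cast hlow ε hε
  · filter_upwards [Ioo_mem_nhdsGT zero_lt_one] with ε hε
    exact_mod_cast hup ε hε

/-! #### The power case -/

/-- The derivative of `u ^ (2k)` lies between `2k * c₁` and `2k * c₂`. Taking the minimum and
maximum with `u 1 ^ (2k)` turns the affine bounds in `s - 1` into bounds proportional to `s`. -/
theorem exists_pow_bounds (h : SpiralGrowth k κ u) (hk : 1 ≤ k) :
    ∃ m > 0, ∃ M > 0, ∀ s, 1 ≤ s → m * s ≤ u s ^ (2 * k) ∧ u s ^ (2 * k) ≤ M * s := by
  obtain ⟨v, c₁, c₂, C, hc₁, hv⟩ := h.exists_deriv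
  have hu1 := h.pos 1 le_rfl
  have hk0 : (0 : ℝ) < 2 * k := by exact_mod_cast (by omega : 0 < 2 * k)
  have hder : ∀ x, 1 ≤ x → HasDerivAt (fun x => u x ^ (2 * k))
      (2 * k * (v x * u x ^ (2 * k) / u x)) x := fun x hx => by
    have hu := h.pos x hx
    refine ((hv x hx).1.fun_pow (2 * k)).congr_deriv ?_
    obtain ⟨j, hj⟩ : ∃ j, 2 * k = j + 1 := ⟨2 * k - 1, by omega⟩
    rw [show ((2 * k : ℕ) : ℝ) = 2 * k by push_cast; ring, hj, Nat.add_sub_cancel, pow_succ]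
    field_simp
  have hlo : ∀ s, 1 ≤ s → 2 * k * c₁ * (s - 1) ≤ u s ^ (2 * k) - u 1 ^ (2 * k) := fun s hs =>
    mul_sub_le_image_sub_of_hasDerivAt hs (fun x hx => hder x hx.1) fun x hx => by
      have : c₁ ≤ v x * u x ^ (2 * k) / u x := by
        rw [le_div_iff₀ (h.pos x hx.1)]; exact (hv x hx.1).2.1
      gcongr
  have hup : ∀ s, 1 ≤ s → u s ^ (2 * k) - u 1 ^ (2 * k) ≤ 2 * k * c₂ * (s - 1) := fun s hs =>
    image_sub_le_mul_sub_of_hasDerivAt hs (fun x hx => hder x hx.1) fun x hx => by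
      have : v x * u x ^ (2 * k) / u x ≤ c₂ := by
        rw [div_le_iff₀ (h.pos x hx.1)]; exact (hv x hx.1).2.2.1
      gcongr
  refine ⟨min (u 1 ^ (2 * k)) (2 * k * c₁), by positivity, max (u 1 ^ (2 * k)) (2 * k * c₂),
    lt_max_of_lt_left (by positivity), fun s hs => ⟨?_, ?_⟩⟩
  · have h1 := hlo s hs
    have h2 := min_le_left (u 1 ^ (2 * k)) (2 * k * c₁)
    have h3 := min_le_right (u 1 ^ (2 * k)) (2 * k * c₁)
    nlinarith
  · have h1 := hup s hs
    have h2 := le_max_left (u 1 ^ (2 * k)) (2 * k * c₂)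
    have h3 := le_max_right (u 1 ^ (2 * k)) (2 * k * c₂)
    nlinarith

theorem exists_rpow_bounds (h : SpiralGrowth k κ u) (hk : 1 ≤ k) :
    ∃ m > 0, ∃ M > 0, ∀ s, 1 ≤ s →
      (m * s) ^ (1 / (2 * (k : ℝ))) ≤ u s ∧ u s ≤ (M * s) ^ (1 / (2 * (k : ℝ))) := by
  obtain ⟨m, hm, M, hM, hb⟩ := h.exists_pow_bounds hk
  refine ⟨m, hm, M, hM, fun s hs => ?_⟩
  have hu := h.pos s hs
  have hroot : u s = (u s ^ (2 * k)) ^ (1 / (2 * (k : ℝ))) := by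
    have := Real.pow_rpow_inv_natCast hu.le (show 2 * k ≠ 0 by omega)
    rw [one_div]
    exact_mod_cast this.symm
  constructor
  · rw [hroot]
    gcongr
    exact (hb s hs).1
  · conv_lhs => rw [hroot]
    gcongr
    exact (hb s hs).2

theorem comparable_rpow (h : SpiralGrowth k κ u) (hk : 1 ≤ k) (c : ℝ) :
    Comparable atTop (fun x => u (x + c)) (fun x => |x| ^ ((1 : ℝ) / (2 * (k : ℝ)))) := by
  obtain ⟨m, hm, M, hM, hb⟩ := h.exists_rpow_bounds hk
  refine ⟨(m / 2) ^ (1 / (2 * (k : ℝ))), by positivity, (M * 2) ^ (1 / (2 * (k : ℝ))),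
    by positivity, ?_⟩
  -- In this range `x / 2 ≤ x + c ≤ 2 * x`, which accounts for the constants `m / 2` and `M * 2`.
  filter_upwards [eventually_ge_atTop (2 * |c| + 1), eventually_ge_atTop (1 - c)] with x hx hx1
  have hc1 := neg_abs_le c
  have hc2 := le_abs_self c
  have hc3 := abs_nonneg c
  have hx0 : 0 < x := by linarith
  obtain ⟨h1, h2⟩ := hb (x + c) (by linarith)
  rw [abs_of_pos hx0, ← Real.mul_rpow (by positivity) hx0.le,
    ← Real.mul_rpow (by positivity) hx0.le]
  constructor
  · refine le_trans ?_ h1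
    gcongr ?_ ^ _
    nlinarith
  · refine h2.trans ?_
    have : 0 ≤ x + c := by linarith
    gcongr ?_ ^ _
    nlinarith

theorem tendsto_atTop_of_one_le (h : SpiralGrowth k κ u) (hk : 1 ≤ k) : Tendsto u atTop atTop := by
  obtain ⟨m, hm, M, hM, hb⟩ := h.exists_rpow_bounds hk
  have hk0 : (0 : ℝ) < k := by exact_mod_cast hk
  refine tendsto_atTop_mono' atTop ?_
    ((tendsto_rpow_atTop (show 0 < 1 / (2 * (k : ℝ)) by positivity)).comp
      (tendsto_id.const_mul_atTop hm))
  filter_upwards [eventually_ge_atTop 1] with s hs using (hb s hs).1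

theorem hasBoxDim_of_one_le (h : SpiralGrowth k κ u) (hk : 1 ≤ k) {σ : ℝ} (hσ : |σ| = 1) (θ₀ : ℝ) :
    HasBoxDim ((fun s => polarPoint (u s)⁻¹ (σ * s + θ₀)) '' Ici 1)
      (4 * (k : ℝ) / (2 * (k : ℝ) + 1)) := by
  obtain ⟨m, hm, M, hM, hb⟩ := h.exists_rpow_bounds hk
  have hk0 : (1 : ℝ) ≤ k := by exact_mod_cast hk
  set α := 1 / (2 * (k : ℝ)) with hα
  have hα0 : 0 < α := by positivity
  have hα1 : α < 1 := by
    rw [hα, div_lt_one (by positivity)]; linarith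
  have hdim : 4 * (k : ℝ) / (2 * (k : ℝ) + 1) = 2 / (1 + α) := by
    rw [hα]; field_simp; ring
  have hinv_le : ∀ s, 1 ≤ s → (u s)⁻¹ ≤ m ^ (-α) * s ^ (-α) := fun s hs => by
    rw [← Real.mul_rpow hm.le (by linarith), Real.rpow_neg (by positivity)]
    have := (hb s hs).1
    gcongr
  have hle_inv : ∀ s, 1 ≤ s → M ^ (-α) * s ^ (-α) ≤ (u s)⁻¹ := fun s hs => by
    rw [← Real.mul_rpow hM.le (by linarith), Real.rpow_neg (by positivity)]
    have := (hb s hs).2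
    have := h.pos s hs
    gcongr
  obtain ⟨C, hC⟩ := h.exists_volume_le (σ := σ) (θ₀ := θ₀) (α := α) (C := m ^ (-α) / (1 - α)) hσ
    hα0 hα1.le (div_nonneg (by positivity) (by linarith)) (fun N _ => by
      calc ∑ n ∈ Finset.range N, (u (1 + n))⁻¹
          ≤ ∑ n ∈ Finset.range N, m ^ (-α) * (1 + (n : ℝ)) ^ (-α) :=
            Finset.sum_le_sum fun n _ => hinv_le _ (by simp)
        _ = m ^ (-α) * ∑ n ∈ Finset.range N, (1 + (n : ℝ)) ^ (-α) := by rw [Finset.mul_sum]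
        _ ≤ m ^ (-α) * ((N : ℝ) ^ (1 - α) / (1 - α)) := by
            gcongr; exact sum_rpow_neg_le hα0.le hα1 N
        _ = _ := by ring)
  obtain ⟨c, hc, hlip⟩ := h.exists_inv_sub_inv_le
  obtain ⟨c', hc', hlow⟩ := exists_le_volume_thickening_spiral (r := fun s => (u s)⁻¹) (σ := σ)
    (θ₀ := θ₀) (α := α) (c := M ^ (-α)) (D := c * (m ^ (-α)) ^ (2 * k + 1)) hσ
    (fun s hs => inv_pos.2 (h.pos s hs)) h.continuousOn_inv
    (h.tendsto_atTop_of_one_le hk).inv_tendsto_atTop hα0 (by positivity) (fun t s ht hts => by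
      have ht0 : 0 < t := by linarith
      rw [abs_of_nonneg (sub_nonneg.2 (h.antitoneOn_inv ht (ht.trans hts) hts))]
      refine (hlip t s ht hts).trans ?_
      have h0 : 0 ≤ s - t := sub_nonneg.2 hts
      have h1 := hinv_le t ht
      have h2 := h.pos t ht
      -- Because `2kα = 1`, the decay rate of `1 / u` has exactly the order `-(1 + α)` required of
      -- the gaps between turns.
      have h3 : (t ^ (-α)) ^ (2 * k + 1) = t ^ (-(1 + α)) := by
        rw [← Real.rpow_natCast, ← Real.rpow_mul ht0.le]
        congr 1
        rw [hα]
        push_cast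
        field_simp
      calc c * (u t)⁻¹ ^ (2 * k + 1) * (s - t)
          ≤ c * (m ^ (-α) * t ^ (-α)) ^ (2 * k + 1) * (s - t) := by gcongr
        _ = _ := by rw [mul_pow, h3]; ring) (by positivity) hle_inv
  rw [hdim]
  exact h.hasBoxDim_of_volume hα0 hc' hlow hC

/-! #### The exponential case -/

theorem exists_log_bound (h : SpiralGrowth 0 κ u) :
    ∃ B, ∀ s, 1 ≤ s → |Real.log (u s) - κ * s| ≤ B := by
  obtain ⟨v, c₁, c₂, C, hc₁, hv⟩ := h.exists_deriv
  simp only [mul_zero, pow_zero, mul_one] at hv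
  have hu1 := h.pos 1 le_rfl
  have hC : 0 ≤ C := by
    have := (abs_nonneg _).trans (hv 1 le_rfl).2.2.2
    by_contra! hneg
    exact absurd this (not_le.2 (div_neg_of_neg_of_pos hneg hu1))
  have hlog : ∀ x, 1 ≤ x → HasDerivAt (fun x => Real.log (u x) - κ * x) (v x / u x - κ) x :=
    fun x hx => by
      simpa using ((hv x hx).1.log (h.pos x hx).ne').fun_sub ((hasDerivAt_id x).const_mul κ)
  -- The corrector `E / u ^ 2` decreases at rate at least `C / u ^ 2`, which absorbs the error in
  -- `(log u - κ s)'` without prior knowledge of how fast `u` grows. Adding it gives a nonincreasing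
  -- function, subtracting it a nondecreasing one.
  set E := C / (2 * c₁) with hE
  have hE0 : 0 ≤ E := by positivity
  have hw : ∀ x, 1 ≤ x → HasDerivAt (fun x => E * (u x ^ 2)⁻¹)
      (E * (-(2 * u x * v x) / (u x ^ 2) ^ 2)) x := fun x hx => by
    have hu := h.pos x hx
    simpa using (((hv x hx).1.fun_pow 2).fun_inv (pow_ne_zero 2 hu.ne')).const_mul E
  have hbound : ∀ x, 1 ≤ x → E * (-(2 * u x * v x) / (u x ^ 2) ^ 2) ≤ -(C / u x ^ 2) :=
    fun x hx => by
      have hu := h.pos x hx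
      have h1 : C / u x ^ 2 = E * (2 * u x * (c₁ * u x) / (u x ^ 2) ^ 2) := by
        rw [hE]; field_simp
      rw [h1, neg_div, mul_neg]
      refine neg_le_neg ?_
      have := (hv x hx).2.1
      gcongr
  have hder : ∀ x, 1 ≤ x → |v x / u x - κ| ≤ C / u x ^ 2 := fun x hx => by
    have hu := h.pos x hx
    have h1 : v x / u x - κ = (v x - κ * u x) / u x := by field_simp
    rw [h1, abs_div, abs_of_pos hu, div_le_iff₀ hu]
    refine (hv x hx).2.2.2.trans (le_of_eq ?_)
    field_simp
  refine ⟨|Real.log (u 1) - κ * 1| + E * (u 1 ^ 2)⁻¹, fun s hs => ?_⟩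
  have hs0 := h.pos s hs
  have hpos : 0 ≤ E * (u s ^ 2)⁻¹ := by positivity
  have hup := image_sub_le_mul_sub_of_hasDerivAt (a := 0) hs
    (fun x hx => (hlog x hx.1).add (hw x hx.1)) fun x hx => by
      linarith [hbound x hx.1, (abs_le.1 (hder x hx.1)).2]
  have hlo := mul_sub_le_image_sub_of_hasDerivAt (a := 0) hs
    (fun x hx => (hlog x hx.1).sub (hw x hx.1)) fun x hx => by
      linarith [hbound x hx.1, (abs_le.1 (hder x hx.1)).1]
  simp only [Pi.add_apply, Pi.sub_apply] at hup hlo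
  have h1 := neg_abs_le (Real.log (u 1) - κ * 1)
  have h2 := le_abs_self (Real.log (u 1) - κ * 1)
  rw [abs_le]
  constructor <;> linarith

theorem exists_exp_bounds (h : SpiralGrowth 0 κ u) :
    ∃ B, ∀ s, 1 ≤ s → Real.exp (κ * s - B) ≤ u s ∧ u s ≤ Real.exp (κ * s + B) := by
  obtain ⟨B, hB⟩ := h.exists_log_bound
  refine ⟨B, fun s hs => ?_⟩
  have h1 := abs_le.1 (hB s hs)
  constructor
  · rw [← Real.le_log_iff_exp_le (h.pos s hs)]; linarith
  · rw [← Real.log_le_iff_le_exp (h.pos s hs)]; linarith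

theorem comparable_exp (h : SpiralGrowth 0 κ u) (c : ℝ) :
    Comparable atTop (fun x => u (x + c)) (fun x => Real.exp (κ * x)) := by
  obtain ⟨B, hB⟩ := h.exists_exp_bounds
  refine ⟨Real.exp (κ * c - B), Real.exp_pos _, Real.exp (κ * c + B), Real.exp_pos _, ?_⟩
  filter_upwards [eventually_ge_atTop (1 - c)] with x hx
  obtain ⟨h1, h2⟩ := hB (x + c) (by linarith)
  rw [← Real.exp_add, ← Real.exp_add]
  exact ⟨by convert h1 using 2; ring, by convert h2 using 2; ring⟩

theorem tendsto_atTop_of_zero (h : SpiralGrowth 0 κ u) : Tendsto u atTop atTop := by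
  obtain ⟨B, hB⟩ := h.exists_exp_bounds
  refine tendsto_atTop_mono' atTop ?_ (Real.tendsto_exp_atTop.comp
    (tendsto_atTop_add_const_right atTop (-B) (tendsto_id.const_mul_atTop h.rate_pos)))
  filter_upwards [eventually_ge_atTop 1] with s hs using (hB s hs).1

theorem tendsto_atTop (h : SpiralGrowth k κ u) : Tendsto u atTop atTop := by
  rcases Nat.eq_zero_or_pos k with rfl | hk
  · exact h.tendsto_atTop_of_zero
  · exact h.tendsto_atTop_of_one_le hk

/-- The radii are dominated by a geometric series, so the upper estimate applies with `α = 1`.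
Below, it suffices that the first stretch of the spiral has norms filling a nondegenerate interval.
-/
theorem hasBoxDim_of_zero (h : SpiralGrowth 0 κ u) {σ : ℝ} (hσ : |σ| = 1) (θ₀ : ℝ) :
    HasBoxDim ((fun s => polarPoint (u s)⁻¹ (σ * s + θ₀)) '' Ici 1) 1 := by
  obtain ⟨B, hB⟩ := h.exists_exp_bounds
  have hκ := h.rate_pos
  set q := Real.exp (-κ) with hq
  have hq1 : q < 1 := Real.exp_lt_one_iff.2 (by linarith)
  have hq0 : 0 < q := Real.exp_pos _
  have hinv : ∀ n : ℕ, (u (1 + n))⁻¹ ≤ Real.exp (B - κ) * q ^ n := fun n => by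
    rw [hq, ← Real.exp_nat_mul, ← Real.exp_add]
    have := (hB (1 + n) (by simp)).1
    calc (u (1 + n))⁻¹ ≤ (Real.exp (κ * (1 + n) - B))⁻¹ := by gcongr
      _ = _ := by rw [← Real.exp_neg]; congr 1; ring
  obtain ⟨C, hC⟩ := h.exists_volume_le (σ := σ) (θ₀ := θ₀) (α := 1)
    (C := Real.exp (B - κ) * (1 - q)⁻¹) hσ zero_lt_one le_rfl
    (mul_nonneg (Real.exp_pos _).le (inv_nonneg.2 (by linarith))) (fun N _ => by
      calc ∑ n ∈ Finset.range N, (u (1 + n))⁻¹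
          ≤ ∑ n ∈ Finset.range N, Real.exp (B - κ) * q ^ n := Finset.sum_le_sum fun n _ => hinv n
        _ = Real.exp (B - κ) * ∑ n ∈ Finset.range N, q ^ n := by rw [Finset.mul_sum]
        _ ≤ Real.exp (B - κ) * (1 - q)⁻¹ := by
            gcongr
            rw [← tsum_geometric_of_lt_one hq0.le hq1]
            exact (summable_geometric_of_lt_one hq0.le hq1).sum_le_tsum _
              fun n _ => by positivity
        _ = _ := by simp)
  have hlt : (u 2)⁻¹ < (u 1)⁻¹ := by
    have h1 := h.pos 1 le_rfl
    have := h.strictMonoOn (mem_Ici.2 le_rfl) (mem_Ici.2 one_le_two) one_lt_two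
    gcongr
  have hnorm : Icc (u 2)⁻¹ (u 1)⁻¹ ⊆
      norm '' ((fun s => polarPoint (u s)⁻¹ (σ * s + θ₀)) '' Ici 1) := fun y hy => by
    obtain ⟨s, hs, hsy⟩ := intermediate_value_Icc' one_le_two
      (h.continuousOn_inv.mono Icc_subset_Ici_self) hy
    refine ⟨_, mem_image_of_mem _ (mem_Ici.2 hs.1), ?_⟩
    rw [norm_polarPoint, abs_of_pos (inv_pos.2 (h.pos s hs.1))]
    exact hsy
  have hdim : 2 / (1 + 1) = (1 : ℝ) := by norm_num
  suffices hsuff : HasBoxDim ((fun s => polarPoint (u s)⁻¹ (σ * s + θ₀)) '' Ici 1)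
      (2 / (1 + 1)) by rwa [hdim] at hsuff
  refine h.hasBoxDim_of_volume (c := Real.pi * ((u 1)⁻¹ - (u 2)⁻¹) / 2) zero_lt_one ?_ ?_ hC
  · have := sub_pos.2 hlt
    have := Real.pi_pos
    positivity
  · intro ε hε
    rw [hdim, show (2 : ℝ) - 1 = 1 by norm_num, Real.rpow_one]
    exact le_volume_thickening_of_Icc_subset_norm hlt.le hnorm hε.1

end SpiralGrowth

/-! ### Planar spirals from the growth of the radius -/

namespace SpiralGrowth

variable {k : ℕ} {κ : ℝ} {u : ℝ → ℝ}

theorem hasBoxDimUnbounded (h : SpiralGrowth k κ u) {σ θ₀ d : ℝ}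
    (hd : HasBoxDim ((fun s => polarPoint (u s)⁻¹ (σ * s + θ₀)) '' Ici 1) d) :
    HasBoxDimUnbounded ((fun s => polarPoint (u s) (σ * s + θ₀)) '' Ici 1) d := by
  refine ⟨fun hb => ?_, ?_, ?_⟩
  · obtain ⟨M, hM⟩ := isBounded_iff_forall_norm_le.1 hb
    obtain ⟨s, hs, hsM⟩ :=
      ((eventually_ge_atTop 1).and (h.tendsto_atTop.eventually (eventually_gt_atTop M))).exists
    have := hM _ (mem_image_of_mem _ hs)
    rw [norm_polarPoint, abs_of_pos (h.pos s hs)] at this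
    linarith
  · refine (h.pos 1 le_rfl).trans_le ((Metric.le_infDist (nonempty_Ici.image _)).2 ?_)
    rintro _ ⟨s, hs, rfl⟩
    rw [dist_zero_left, norm_polarPoint, abs_of_pos (h.pos s hs)]
    exact h.strictMonoOn.monotoneOn (mem_Ici.2 le_rfl) hs hs
  · rw [image_image]
    convert hd using 1
    exact image_congr fun s hs => inversion_polarPoint (h.pos s hs) _

theorem isForwardSpiralComparable {S : Set ℝ} {ρ φ f : ℝ → ℝ} {t₀ : ℝ}
    (h : SpiralGrowth k κ fun s => ρ (t₀ + (s - 1))) (hS : S = Ici t₀)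
    (hφ : ∀ t ∈ S, φ t = φ t₀ + (t - t₀))
    (hf : ∀ c, Comparable atTop (fun x => ρ (t₀ + (x + c - 1))) f) :
    IsForwardSpiralComparable S ρ φ f := by
  subst hS
  refine ⟨φ t₀, fun x => ρ (t₀ + (x - φ t₀)), ?_, ?_, ?_, ?_, ?_⟩
  · ext x
    constructor
    · rintro ⟨t, ht, rfl⟩
      rw [hφ t ht, mem_Ici]
      linarith [mem_Ici.1 ht]
    · intro hx
      have hmem : t₀ + (x - φ t₀) ∈ Ici t₀ := by
        rw [mem_Ici]; linarith [mem_Ici.1 hx]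
      exact ⟨_, hmem, by rw [hφ _ hmem]; ring⟩
  · intro t ht
    rw [hφ t ht]
    congr 1
    ring
  · intro x hx y hy hxy
    rw [mem_Ici] at hx hy
    have := h.strictMonoOn (show x - φ t₀ + 1 ∈ Ici 1 by rw [mem_Ici]; linarith)
      (show y - φ t₀ + 1 ∈ Ici 1 by rw [mem_Ici]; linarith) (by linarith)
    simpa using this
  · have := h.tendsto_atTop.comp (tendsto_atTop_add_const_right atTop (1 - φ t₀) tendsto_id)
    refine this.congr fun x => ?_
    simp only [Function.comp_apply, id]
    congr 1
    ring
  · convert hf (1 - φ t₀) using 4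
    ring

theorem isBackwardSpiralComparable {S : Set ℝ} {ρ φ f : ℝ → ℝ} {t₀ : ℝ}
    (h : SpiralGrowth k κ fun s => ρ (t₀ - (s - 1))) (hS : S = Iic t₀)
    (hφ : ∀ t ∈ S, φ t = φ t₀ + (t - t₀))
    (hf : ∀ c, Comparable atTop (fun x => ρ (t₀ - (x + c - 1))) fun x => f (-x)) :
    IsBackwardSpiralComparable S ρ φ f := by
  subst hS
  refine ⟨φ t₀, fun x => ρ (t₀ + (x - φ t₀)), ?_, ?_, ?_, ?_, ?_⟩
  · ext x
    constructor
    · rintro ⟨t, ht, rfl⟩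
      rw [hφ t ht, mem_Iic]
      linarith [mem_Iic.1 ht]
    · intro hx
      have hmem : t₀ + (x - φ t₀) ∈ Iic t₀ := by
        rw [mem_Iic]; linarith [mem_Iic.1 hx]
      exact ⟨_, hmem, by rw [hφ _ hmem]; ring⟩
  · intro t ht
    rw [hφ t ht]
    congr 1
    ring
  · intro x hx y hy hxy
    rw [mem_Iic] at hx hy
    have := h.strictMonoOn (show φ t₀ - y + 1 ∈ Ici 1 by rw [mem_Ici]; linarith)
      (show φ t₀ - x + 1 ∈ Ici 1 by rw [mem_Ici]; linarith) (by linarith)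
    convert this using 2 <;> ring
  · have := h.tendsto_atTop.comp
      ((tendsto_atTop_add_const_right atTop (1 + φ t₀) tendsto_id).comp tendsto_neg_atBot_atTop)
    refine this.congr fun x => ?_
    simp only [Function.comp_apply, id]
    congr 1
    ring
  · obtain ⟨c₁, hc₁, c₂, hc₂, hev⟩ := hf (1 + φ t₀)
    refine ⟨c₁, hc₁, c₂, hc₂, ?_⟩
    filter_upwards [tendsto_neg_atBot_atTop.eventually hev] with x hx
    rw [neg_neg, show t₀ - (-x + (1 + φ t₀) - 1) = t₀ + (x - φ t₀) by ring] at hx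
    exact hx

end SpiralGrowth

/-! ### From asymptotics of the vector field to growth of solutions -/

/-- Beyond `M` the error `C / r` is at most half of `κ * r`; on `[r₀, M]` continuity, positivity and
compactness supply the constants. Thus the bounds hold from the starting radius, not only near
infinity. -/
theorem exists_bounds_of_asymptotics {G : ℝ → ℝ} {k : ℕ} {κ C r₀ : ℝ}
    (hG : ∀ r > 0, ContDiffAt ℝ 1 G r) (hκ : 0 < κ)
    (hasymp : ∀ r, 1 ≤ r → |G r * r ^ (2 * k) - κ * r| ≤ C / r) (hr₀ : 0 < r₀)
    (hpos : ∀ r, r₀ ≤ r → 0 < G r) :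
    ∃ c₁ c₂ C', 0 < c₁ ∧ ∀ r, r₀ ≤ r → c₁ * r ≤ G r * r ^ (2 * k) ∧
      G r * r ^ (2 * k) ≤ c₂ * r ∧ |G r * r ^ (2 * k) - κ * r| ≤ C' / r := by
  have hC : 0 ≤ C := by simpa using (abs_nonneg _).trans (hasymp 1 le_rfl)
  set M := max (max 1 r₀) (2 * C / κ) with hM
  have hM1 : 1 ≤ M := (le_max_left _ _).trans (le_max_left _ _)
  have hMr : r₀ ≤ M := (le_max_right _ _).trans (le_max_left _ _)
  have hMC : 2 * C / κ ≤ M := le_max_right _ _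
  have hcont : ContinuousOn (fun r => G r * r ^ (2 * k)) (Icc r₀ M) := fun r hr =>
    ((hG r (hr₀.trans_le hr.1)).continuousAt.mul (by fun_prop)).continuousWithinAt
  have hid : ContinuousOn (fun r : ℝ => r) (Icc r₀ M) := continuousOn_id
  have hne : ∀ r ∈ Icc r₀ M, r ≠ 0 := fun r hr => (hr₀.trans_le hr.1).ne'
  have hq : ContinuousOn (fun r => G r * r ^ (2 * k) / r) (Icc r₀ M) := hcont.div hid hne
  have hnonempty : (Icc r₀ M).Nonempty := nonempty_Icc.2 hMr
  obtain ⟨x, hx, hxmin⟩ := isCompact_Icc.exists_isMinOn hnonempty hq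
  obtain ⟨y, hy, hymax⟩ := isCompact_Icc.exists_isMaxOn hnonempty hq
  obtain ⟨z, hz, hzmax⟩ := isCompact_Icc.exists_isMaxOn hnonempty
    (((hcont.sub (hid.const_smul κ)).abs).mul hid)
  have hx0 : 0 < x := hr₀.trans_le hx.1
  have hxpos : 0 < G x * x ^ (2 * k) / x := by
    have := hpos x hx.1
    positivity
  refine ⟨min (G x * x ^ (2 * k) / x) (κ / 2), max (G y * y ^ (2 * k) / y) (3 * κ / 2),
    max (|G z * z ^ (2 * k) - κ * z| * z) C, lt_min hxpos (by positivity), fun r hr => ?_⟩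
  have hr0 : 0 < r := hr₀.trans_le hr
  rcases le_total r M with h | h
  · have h1 : G x * x ^ (2 * k) / x ≤ G r * r ^ (2 * k) / r := hxmin ⟨hr, h⟩
    have h2 : G r * r ^ (2 * k) / r ≤ G y * y ^ (2 * k) / y := hymax ⟨hr, h⟩
    have h3 : |G r * r ^ (2 * k) - κ * r| * r ≤ |G z * z ^ (2 * k) - κ * z| * z := hzmax ⟨hr, h⟩
    refine ⟨?_, ?_, ?_⟩
    · rw [← le_div_iff₀ hr0]; exact (min_le_left _ _).trans h1
    · rw [← div_le_iff₀ hr0]; exact h2.trans (le_max_left _ _)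
    · rw [le_div_iff₀ hr0]; exact h3.trans (le_max_left _ _)
  · have h1 := hasymp r (hM1.trans h)
    have h2 : C / r ≤ κ * r / 2 := by
      rw [div_le_iff₀ hr0]
      have h3 := (div_le_iff₀ hκ).1 (hMC.trans h)
      have h4 : r ≤ r * r := by nlinarith [hM1.trans h]
      nlinarith
    have h5 := abs_le.1 h1
    refine ⟨?_, ?_, h1.trans ?_⟩
    · calc _ ≤ κ / 2 * r := by gcongr; exact min_le_right _ _
        _ ≤ _ := by linarith
    · calc _ ≤ 3 * κ / 2 * r := by linarith
        _ ≤ _ := by gcongr; exact le_max_right _ _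
    · gcongr; exact le_max_right _ _

theorem exists_pos_of_asymptotics {G : ℝ → ℝ} {k : ℕ} {κ C : ℝ} (hκ : 0 < κ)
    (hasymp : ∀ r, 1 ≤ r → |G r * r ^ (2 * k) - κ * r| ≤ C / r) :
    ∃ R > 0, ∀ r, R ≤ r → 0 < G r := by
  have hC : 0 ≤ C := by simpa using (abs_nonneg _).trans (hasymp 1 le_rfl)
  refine ⟨max 1 (2 * C / κ), by positivity, fun r hr => ?_⟩
  have hr1 : 1 ≤ r := (le_max_left _ _).trans hr
  have hr0 : 0 < r := by linarith
  have h1 := abs_le.1 (hasymp r hr1)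
  have h2 : C / r ≤ κ * r / 2 := by
    rw [div_le_iff₀ hr0]
    have h3 := (div_le_iff₀ hκ).1 ((le_max_right _ _).trans hr)
    have h4 : r ≤ r * r := by nlinarith
    nlinarith
  have h3 : 0 < κ * r := by positivity
  exact pos_of_mul_pos_left (show 0 < G r * r ^ (2 * k) by linarith) (by positivity)

namespace IsPositiveSolution

variable {G : ℝ → ℝ} {J : Set ℝ} {ρ : ℝ → ℝ} {t₀ : ℝ}

theorem spiralGrowth (h : IsPositiveSolution G J ρ)
    (hmax : ∀ J' ρ', IsPositiveSolution G J' ρ' → J ⊆ J' → EqOn ρ' ρ J → J' = J)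
    (hG : ∀ r > 0, ContDiffAt ℝ 1 G r) {k : ℕ} {κ C : ℝ} (hκ : 0 < κ)
    (hasymp : ∀ r, 1 ≤ r → |G r * r ^ (2 * k) - κ * r| ≤ C / r)
    (ht₀ : t₀ ∈ J) (hpos : ∀ c, ρ t₀ ≤ c → 0 < G c) :
    Ici t₀ ⊆ J ∧ SpiralGrowth k κ fun s => ρ (t₀ + (s - 1)) := by
  have hr₀ := h.pos t₀ ht₀
  obtain ⟨c₁, c₂, C', hc₁, hb⟩ := exists_bounds_of_asymptotics hG hκ hasymp hr₀ hpos
  have hsub : Ici t₀ ⊆ J := by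
    -- Linear growth for `r ≥ ρ t₀`, since there `r ^ (2k)` is at least `ρ t₀ ^ (2k)`.
    refine h.Ici_subset hG hmax ht₀ hpos (C := c₂ / ρ t₀ ^ (2 * k)) fun r hr => ?_
    rw [div_mul_eq_mul_div, le_div_iff₀ (by positivity)]
    refine le_trans ?_ (hb r hr).2.1
    have := hpos r hr
    gcongr
  have hmem : ∀ s, 1 ≤ s → t₀ + (s - 1) ∈ J := fun s hs => hsub (by rw [mem_Ici]; linarith)
  refine ⟨hsub, fun s hs => h.pos _ (hmem s hs), hκ,
    fun s => G (ρ (t₀ + (s - 1))), c₁, c₂, C', hc₁, fun s hs => ⟨?_, ?_⟩⟩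
  · have h1 : HasDerivAt (fun s => t₀ + (s - 1)) 1 s := by
      simpa using ((hasDerivAt_id s).sub_const 1).const_add t₀
    exact ((h.hasDerivAt _ (hmem s hs)).comp s h1).congr_deriv (mul_one _)
  · exact hb _ (h.le_of_pos ht₀ hpos (hmem s hs) (by linarith))

theorem reflect (h : IsPositiveSolution G J ρ) :
    IsPositiveSolution (fun r => -G r) (Neg.neg ⁻¹' J) (fun t => ρ (-t)) where
  isOpen := h.isOpen.preimage continuous_neg
  ordConnected := ⟨fun _ hx _ hy _ hz =>
    h.Icc_subset hy hx ⟨neg_le_neg hz.2, neg_le_neg hz.1⟩⟩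
  pos _ ht := h.pos _ ht
  hasDerivAt t ht :=
    ((h.hasDerivAt (-t) ht).comp t (hasDerivAt_neg t)).congr_deriv (mul_neg_one _)

theorem reflect_maximal
    (hmax : ∀ J' ρ', IsPositiveSolution G J' ρ' → J ⊆ J' → EqOn ρ' ρ J → J' = J)
    (J' : Set ℝ) (ρ' : ℝ → ℝ) (h' : IsPositiveSolution (fun r => -G r) J' ρ')
    (hsub : Neg.neg ⁻¹' J ⊆ J') (heq : EqOn ρ' (fun t => ρ (-t)) (Neg.neg ⁻¹' J)) :
    J' = Neg.neg ⁻¹' J := by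
  have h1 : IsPositiveSolution G (Neg.neg ⁻¹' J') (fun t => ρ' (-t)) := by
    simpa using h'.reflect
  have h2 := hmax _ _ h1 (fun x hx => hsub (by simpa using hx)) fun x hx => by
    simpa using heq (show -x ∈ Neg.neg ⁻¹' J by simpa using hx)
  rw [← h2, ← preimage_comp]
  simp

end IsPositiveSolution

/-! ### The inverted Hopf-Takens normal form -/

theorem hopfTakensRadial_eq (l : ℕ) (a : ℕ → ℝ) (r : ℝ) : hopfTakensRadial l a r =
    -r * (r⁻¹ ^ (2 * l) + ∑ j ∈ Finset.range l, a j * r⁻¹ ^ (2 * j)) := by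
  have h : ∀ j : ℕ, r ^ (-(2 * (j : ℤ))) = r⁻¹ ^ (2 * j) := fun j => by
    rw [zpow_neg, inv_pow]
    congr 1
  simp only [hopfTakensRadial, h]

theorem contDiffAt_hopfTakensRadial (l : ℕ) (a : ℕ → ℝ) {r : ℝ} (hr : 0 < r) :
    ContDiffAt ℝ 1 (hopfTakensRadial l a) r := by
  rw [funext (hopfTakensRadial_eq l a)]
  have hinv : ContDiffAt ℝ 1 (fun r : ℝ => r⁻¹) r := contDiffAt_inv ℝ hr.ne'
  refine contDiffAt_id.neg.mul ((hinv.pow _).add (ContDiffAt.sum fun j _ => ?_))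
  exact contDiffAt_const.mul (hinv.pow _)

/-- After multiplication by `r ^ (2k)` the term of index `j` has order `r ^ (1 - 2(j - k))`: terms
with `j < k` vanish, `j = k` is the main term, and those with `j > k` are at most `|a j| / r` for `r
≥ 1`. The normalisation `a l = 1` puts the leading monomial into the same sum. -/
theorem exists_hopfTakensRadial_asymptotics {l : ℕ} {a : ℕ → ℝ} (hal : a l = 1) {k : ℕ}
    (hkl : k ≤ l) (hzero : ∀ j < k, a j = 0) :
    ∃ C, ∀ r, 1 ≤ r → |hopfTakensRadial l a r * r ^ (2 * k) + a k * r| ≤ C / r := by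
  refine ⟨∑ j ∈ (Finset.range (l + 1)).erase k, |a j|, fun r hr => ?_⟩
  have hr0 : 0 < r := by linarith
  have hmem : k ∈ Finset.range (l + 1) := Finset.mem_range.2 (by omega)
  have hF : hopfTakensRadial l a r * r ^ (2 * k) + a k * r =
      -∑ j ∈ (Finset.range (l + 1)).erase k, a j * (r * r⁻¹ ^ (2 * j) * r ^ (2 * k)) := by
    have h1 : hopfTakensRadial l a r * r ^ (2 * k) =
        -∑ j ∈ Finset.range (l + 1), a j * (r * r⁻¹ ^ (2 * j) * r ^ (2 * k)) := by
      rw [hopfTakensRadial_eq, Finset.sum_range_succ, hal]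
      have : ∑ j ∈ Finset.range l, a j * (r * r⁻¹ ^ (2 * j) * r ^ (2 * k)) =
          (∑ j ∈ Finset.range l, a j * r⁻¹ ^ (2 * j)) * (r * r ^ (2 * k)) := by
        rw [Finset.sum_mul]
        exact Finset.sum_congr rfl fun j _ => by ring
      rw [this]
      ring
    rw [h1, ← Finset.add_sum_erase _ _ hmem]
    have h2 : r⁻¹ ^ (2 * k) * r ^ (2 * k) = 1 := by
      rw [← mul_pow, inv_mul_cancel₀ hr0.ne', one_pow]
    linear_combination (-(a k * r)) * h2
  rw [hF, abs_neg, Finset.sum_div]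
  refine (Finset.abs_sum_le_sum_abs _ _).trans (Finset.sum_le_sum fun j hj => ?_)
  rw [abs_mul]
  rcases lt_or_gt_of_ne (Finset.ne_of_mem_erase hj) with h | h
  · simp [hzero j h]
  · rw [div_eq_mul_inv, abs_of_pos (show 0 < r * r⁻¹ ^ (2 * j) * r ^ (2 * k) by positivity)]
    gcongr
    obtain ⟨i, rfl⟩ : ∃ i, j = k + 1 + i := ⟨j - (k + 1), by omega⟩
    have h2 : r * r⁻¹ ^ (2 * (k + 1 + i)) * r ^ (2 * k) = r⁻¹ * r⁻¹ ^ (2 * i) := by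
      rw [show 2 * (k + 1 + i) = 2 * k + 2 + 2 * i by ring, pow_add, pow_add]
      simp only [inv_pow]
      field_simp
    rw [h2]
    exact mul_le_of_le_one_right (by positivity)
      (pow_le_one₀ (by positivity) (inv_le_one_of_one_le₀ hr))

namespace IsHopfTakensTrajectory

variable {l : ℕ} {a : ℕ → ℝ} {J : Set ℝ} {ρ φ : ℝ → ℝ} {t₀ : ℝ}

theorem isPositiveSolution (h : IsHopfTakensTrajectory l a J ρ φ) :
    IsPositiveSolution (hopfTakensRadial l a) J ρ :=
  ⟨h.isOpen, h.ordConnected, h.pos, h.hasDerivAt_radius⟩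

theorem angle_eq (h : IsHopfTakensTrajectory l a J ρ φ) {t : ℝ} (ht₀ : t₀ ∈ J) (ht : t ∈ J) :
    φ t = φ t₀ + (t - t₀) := by
  have key : ∀ x ∈ J, ∀ y ∈ J, x ≤ y → φ y - φ x = y - x := fun x hx y hy hxy => by
    have hsub : ∀ z ∈ Icc x y, HasDerivAt φ 1 z := fun z hz =>
      h.hasDerivAt_angle z (h.ordConnected.out hx hy hz)
    have h1 := mul_sub_le_image_sub_of_hasDerivAt (a := 1) hxy hsub fun _ _ => le_rfl
    have h2 := image_sub_le_mul_sub_of_hasDerivAt (a := 1) hxy hsub fun _ _ => le_rfl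
    linarith
  rcases le_total t₀ t with h1 | h1
  · linarith [key _ ht₀ _ ht h1]
  · linarith [key _ ht _ ht₀ h1]

/-- The angle is affine in time and extends to any interval, so only the radius can obstruct
continuation. -/
theorem radius_maximal (h : IsHopfTakensTrajectory l a J ρ φ) (J' : Set ℝ) (ρ' : ℝ → ℝ)
    (h' : IsPositiveSolution (hopfTakensRadial l a) J' ρ') (hsub : J ⊆ J') (heq : EqOn ρ' ρ J) :
    J' = J := by
  obtain ⟨t₁, ht₁⟩ := h.nonempty
  refine h.maximal J' ρ' (fun t => φ t₁ + (t - t₁)) ⟨⟨t₁, hsub ht₁⟩, h'.isOpen, h'.ordConnected,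
    h'.pos, h'.hasDerivAt, fun t _ => ?_⟩ hsub heq fun t ht => (h.angle_eq ht₁ ht).symm
  simpa using ((hasDerivAt_id t).sub_const t₁).const_add (φ t₁)

theorem spiralGrowth_forward (h : IsHopfTakensTrajectory l a J ρ φ) (hal : a l = 1) {k : ℕ}
    (hkl : k ≤ l) (hzero : ∀ j < k, a j = 0) (hak : a k < 0) (ht₀ : t₀ ∈ J)
    (hpos : ∀ c, ρ t₀ ≤ c → 0 < hopfTakensRadial l a c) :
    Ici t₀ ⊆ J ∧ SpiralGrowth k |a k| fun s => ρ (t₀ + (s - 1)) := by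
  obtain ⟨C, hC⟩ := exists_hopfTakensRadial_asymptotics hal hkl hzero
  refine h.isPositiveSolution.spiralGrowth h.radius_maximal
    (fun r hr => contDiffAt_hopfTakensRadial l a hr) (abs_pos.2 hak.ne) (C := C)
    (fun r hr => ?_) ht₀ hpos
  rw [abs_of_neg hak, neg_mul, sub_neg_eq_add]
  exact hC r hr

theorem spiralGrowth_backward (h : IsHopfTakensTrajectory l a J ρ φ) (hal : a l = 1) {k : ℕ}
    (hkl : k ≤ l) (hzero : ∀ j < k, a j = 0) (hak : 0 < a k) (ht₀ : t₀ ∈ J)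
    (hpos : ∀ c, ρ t₀ ≤ c → 0 < -hopfTakensRadial l a c) :
    Iic t₀ ⊆ J ∧ SpiralGrowth k |a k| fun s => ρ (t₀ - (s - 1)) := by
  obtain ⟨C, hC⟩ := exists_hopfTakensRadial_asymptotics hal hkl hzero
  obtain ⟨h1, h2⟩ := h.isPositiveSolution.reflect.spiralGrowth (t₀ := -t₀)
    (IsPositiveSolution.reflect_maximal h.radius_maximal)
    (fun r hr => (contDiffAt_hopfTakensRadial l a hr).neg) (abs_pos.2 hak.ne') (C := C)
    (fun r hr => by
      rw [abs_of_pos hak, show -hopfTakensRadial l a r * r ^ (2 * k) - a k * r =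
        -(hopfTakensRadial l a r * r ^ (2 * k) + a k * r) by ring, abs_neg]
      exact hC r hr) (by simpa using ht₀) (by simpa using hpos)
  refine ⟨fun t ht => ?_, ?_⟩
  · have : -t ∈ Ici (-t₀) := neg_le_neg (mem_Iic.1 ht)
    simpa using h1 this
  · convert h2 using 3
    ring

end IsHopfTakensTrajectory

/-! ### Direction of time and the main theorem -/

theorem exists_sign_hopfTakensRadial {l : ℕ} {a : ℕ → ℝ} (hal : a l = 1) {k : ℕ}
    (hkl : k ≤ l) (hzero : ∀ j < k, a j = 0) (hak : a k ≠ 0) :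
    ∃ R > 0, (a k < 0 → ∀ r, R ≤ r → 0 < hopfTakensRadial l a r) ∧
      (0 < a k → ∀ r, R ≤ r → 0 < -hopfTakensRadial l a r) := by
  obtain ⟨C, hC⟩ := exists_hopfTakensRadial_asymptotics hal hkl hzero
  rcases lt_or_gt_of_ne hak with h | h
  · obtain ⟨R, hR, hpos⟩ := exists_pos_of_asymptotics (G := hopfTakensRadial l a) (k := k) (C := C)
      (abs_pos.2 hak) fun r hr => by
        rw [abs_of_neg h, neg_mul, sub_neg_eq_add]; exact hC r hr
    exact ⟨R, hR, fun _ => hpos, fun h' => absurd h' (not_lt.2 h.le)⟩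
  · obtain ⟨R, hR, hpos⟩ := exists_pos_of_asymptotics (G := fun r => -hopfTakensRadial l a r)
      (k := k) (C := C) (abs_pos.2 hak) fun r hr => by
        rw [abs_of_pos h, show -hopfTakensRadial l a r * r ^ (2 * k) - a k * r =
          -(hopfTakensRadial l a r * r ^ (2 * k) + a k * r) by ring, abs_neg]
        exact hC r hr
    exact ⟨R, hR, fun h' => absurd h' (not_lt.2 h.le), fun _ => hpos⟩

/-- Every part of a trajectory near infinity is a spiral in the direction of time determined by the
sign of the leading coefficient. -/
theorem IsPartNearInfinity.spiralGrowth {l : ℕ} {a : ℕ → ℝ} (hal : a l = 1) {k : ℕ}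
    (hkl : k ≤ l) (hzero : ∀ j < k, a j = 0) (hak : a k ≠ 0) {S : Set ℝ} {ρ φ : ℝ → ℝ}
    (hS : IsPartNearInfinity l a S ρ φ) :
    ∃ t₀, (∀ t ∈ S, φ t = φ t₀ + (t - t₀)) ∧
      ((a k < 0 ∧ S = Ici t₀ ∧ SpiralGrowth k |a k| fun s => ρ (t₀ + (s - 1))) ∨
        (0 < a k ∧ S = Iic t₀ ∧ SpiralGrowth k |a k| fun s => ρ (t₀ - (s - 1)))) := by
  obtain ⟨J, h, t₀, ht₀, hS, hunb⟩ := hS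
  obtain ⟨R, -, hneg, hpos⟩ := exists_sign_hopfTakensRadial hal hkl hzero hak
  refine ⟨t₀, fun t ht => h.angle_eq ht₀ ?_, ?_⟩
  · rcases hS with rfl | rfl <;> exact ht.1
  have hcd : ∀ r > 0, ContDiffAt ℝ 1 (hopfTakensRadial l a) r := fun r hr =>
    contDiffAt_hopfTakensRadial l a hr
  rcases hS with rfl | rfl
  · have hF : ∀ c, ρ t₀ ≤ c → 0 < hopfTakensRadial l a c := fun c hc =>
      h.isPositiveSolution.pos_of_not_bddAbove hcd ht₀ hunb hc
    -- The two sign statements for the vector field, one from unboundedness and one from the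
    -- asymptotics, are compared at a common level `max (ρ t₀) R`.
    have hak' : a k < 0 := by
      refine hak.lt_of_le (not_lt.1 fun h' => ?_)
      have h1 := hF (max (ρ t₀) R) (le_max_left _ _)
      have h2 := hpos h' (max (ρ t₀) R) (le_max_right _ _)
      linarith
    obtain ⟨h1, h2⟩ := h.spiralGrowth_forward hal hkl hzero hak' ht₀ hF
    exact Or.inl ⟨hak', inter_eq_right.2 h1, h2⟩
  · have hF : ∀ c, ρ t₀ ≤ c → 0 < -hopfTakensRadial l a c := fun c hc => by
      refine h.isPositiveSolution.reflect.pos_of_not_bddAbove (t₀ := -t₀)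
        (fun r hr => (hcd r hr).neg) (by simpa using ht₀) (fun hb => hunb (hb.mono ?_))
        (by simpa using hc)
      rintro _ ⟨t, ht, rfl⟩
      exact ⟨-t, ⟨by simpa using ht.1, mem_Ici.2 (neg_le_neg (mem_Iic.1 ht.2))⟩, by simp⟩
    have hak' : 0 < a k := by
      refine hak.symm.lt_of_le (not_lt.1 fun h' => ?_)
      have h1 := hF (max (ρ t₀) R) (le_max_left _ _)
      have h2 := hneg h' (max (ρ t₀) R) (le_max_right _ _)
      linarith
    obtain ⟨h1, h2⟩ := h.spiralGrowth_backward hal hkl hzero hak' ht₀ hF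
    exact Or.inr ⟨hak', inter_eq_right.2 h1, h2⟩

/-- The conclusions on spirals, given the growth rate `f₀` and the box dimension `d` of all curves
of a given type of growth. -/
theorem IsPartNearInfinity.spiral {l : ℕ} {a : ℕ → ℝ} (hal : a l = 1) {k : ℕ}
    (hkl : k ≤ l) (hzero : ∀ j < k, a j = 0) (hak : a k ≠ 0) {S : Set ℝ} {ρ φ f f₀ : ℝ → ℝ} {d : ℝ}
    (hS : IsPartNearInfinity l a S ρ φ)
    (hcomp : ∀ u, SpiralGrowth k |a k| u → ∀ c, Comparable atTop (fun x => u (x + c)) f₀)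
    (hdim : ∀ u, SpiralGrowth k |a k| u → ∀ σ : ℝ, |σ| = 1 → ∀ θ₀,
      HasBoxDim ((fun s => polarPoint (u s)⁻¹ (σ * s + θ₀)) '' Ici 1) d)
    (hf_neg : a k < 0 → f₀ = f) (hf_pos : 0 < a k → f₀ = fun x => f (-x)) :
    (a k < 0 → IsForwardSpiralComparable S ρ φ f) ∧
      (0 < a k → IsBackwardSpiralComparable S ρ φ f) ∧
      HasBoxDimUnbounded (polarCurve S ρ φ) d := by
  obtain ⟨t₀, hφ, ⟨ha, hS, hg⟩ | ⟨ha, hS, hg⟩⟩ := hS.spiralGrowth hal hkl hzero hak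
  · refine ⟨fun _ => hg.isForwardSpiralComparable hS hφ ?_, fun h => absurd h (not_lt.2 ha.le), ?_⟩
    · rw [← hf_neg ha]
      exact hcomp _ hg
    · convert hg.hasBoxDimUnbounded (hdim _ hg 1 abs_one (φ t₀ - 1)) using 1
      subst hS
      ext x
      constructor
      · rintro ⟨t, ht, rfl⟩
        refine ⟨t - t₀ + 1, by simpa using ht, ?_⟩
        simp only [polarPoint, hφ t ht]
        ring_nf
      · rintro ⟨s, hs, rfl⟩
        have hmem : t₀ + (s - 1) ∈ Ici t₀ := by rw [mem_Ici]; linarith [mem_Ici.1 hs]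
        refine ⟨_, hmem, ?_⟩
        simp only [polarPoint, hφ _ hmem]
        ring_nf
  · refine ⟨fun h => absurd h (not_lt.2 ha.le), fun _ => hg.isBackwardSpiralComparable hS hφ ?_, ?_⟩
    · rw [← hf_pos ha]
      exact hcomp _ hg
    -- With `t = t₀ - (s - 1)` the angle is `-s + (φ t₀ + 1)`.
    · convert hg.hasBoxDimUnbounded (hdim _ hg (-1) (by simp) (φ t₀ + 1)) using 1
      subst hS
      ext x
      constructor
      · rintro ⟨t, ht, rfl⟩
        refine ⟨t₀ - t + 1, by simpa using ht, ?_⟩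
        simp only [polarPoint, hφ t ht]
        ring_nf
      · rintro ⟨s, hs, rfl⟩
        have hmem : t₀ - (s - 1) ∈ Iic t₀ := by rw [mem_Iic]; linarith [mem_Ici.1 hs]
        refine ⟨_, hmem, ?_⟩
        simp only [polarPoint, hφ _ hmem]
        ring_nf

theorem exists_radius_isPartNearInfinity {l : ℕ} {a : ℕ → ℝ} (hal : a l = 1) :
    ∃ R > 0, ∀ (J : Set ℝ) (ρ φ : ℝ → ℝ), IsHopfTakensTrajectory l a J ρ φ →
      ∀ t₀ ∈ J, R ≤ ρ t₀ →
        IsPartNearInfinity l a (J ∩ Ici t₀) ρ φ ∨ IsPartNearInfinity l a (J ∩ Iic t₀) ρ φ := by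
  classical
  -- The normalisation `a l = 1` guarantees a first nonzero coefficient, of index at most `l`, so
  -- both signs of time are covered without separating (a) from (b).
  have hex : ∃ k, a k ≠ 0 := ⟨l, by simp [hal]⟩
  set k := Nat.find hex with hk
  have hkl : k ≤ l := Nat.find_min' hex (by simp [hal])
  have hzero : ∀ j < k, a j = 0 := fun j hj => not_not.1 (Nat.find_min hex hj)
  have hak : a k ≠ 0 := Nat.find_spec hex
  have hunb : ∀ {u : ℝ → ℝ} (M : ℝ), SpiralGrowth k |a k| u → ∃ s, 1 ≤ s ∧ M < u s := fun M hg =>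
    ((eventually_ge_atTop 1).and (hg.tendsto_atTop.eventually (eventually_gt_atTop M))).exists
  obtain ⟨R, hR, hneg, hpos⟩ := exists_sign_hopfTakensRadial hal hkl hzero hak
  refine ⟨R, hR, fun J ρ φ h t₀ ht₀ hRt => ?_⟩
  rcases lt_or_gt_of_ne hak with ha | ha
  · obtain ⟨hsub, hg⟩ := h.spiralGrowth_forward hal hkl hzero ha ht₀ fun c hc =>
      hneg ha c (hRt.trans hc)
    refine Or.inl ⟨J, h, t₀, ht₀, Or.inl rfl, ?_⟩
    rintro ⟨M, hM⟩
    obtain ⟨s, hs, hsM⟩ := hunb M hg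
    have hmem : t₀ + (s - 1) ∈ Ici t₀ := by rw [mem_Ici]; linarith
    exact absurd (hM (mem_image_of_mem ρ ⟨hsub hmem, hmem⟩)) (not_le.2 hsM)
  · obtain ⟨hsub, hg⟩ := h.spiralGrowth_backward hal hkl hzero ha ht₀ fun c hc =>
      hpos ha c (hRt.trans hc)
    refine Or.inr ⟨J, h, t₀, ht₀, Or.inr rfl, ?_⟩
    rintro ⟨M, hM⟩
    obtain ⟨s, hs, hsM⟩ := hunb M hg
    have hmem : t₀ - (s - 1) ∈ Iic t₀ := by rw [mem_Iic]; linarith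
    exact absurd (hM (mem_image_of_mem ρ ⟨hsub hmem, hmem⟩)) (not_le.2 hsM)

theorem theorem4p1 (l : ℕ) (hl : 1 ≤ l) (a : ℕ → ℝ) (hal : a l = 1) :
    -- trajectories through points far away from the origin have parts near infinity
    (∃ R > 0, ∀ (J : Set ℝ) (ρ φ : ℝ → ℝ), IsHopfTakensTrajectory l a J ρ φ →
      ∀ t₀ ∈ J, R ≤ ρ t₀ →
        IsPartNearInfinity l a (J ∩ Ici t₀) ρ φ ∨ IsPartNearInfinity l a (J ∩ Iic t₀) ρ φ) ∧
    -- (a)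
    (a 0 ≠ 0 → ∀ (S : Set ℝ) (ρ φ : ℝ → ℝ), IsPartNearInfinity l a S ρ φ →
      (a 0 < 0 → IsForwardSpiralComparable S ρ φ (fun x => Real.exp (-a 0 * x))) ∧
      (0 < a 0 → IsBackwardSpiralComparable S ρ φ (fun x => Real.exp (-a 0 * x))) ∧
      HasBoxDimUnbounded (polarCurve S ρ φ) 1) ∧
    -- (b)
    (∀ k : ℕ, 1 ≤ k → k ≤ l → (∀ j < k, a j = 0) → a k ≠ 0 →
      ∀ (S : Set ℝ) (ρ φ : ℝ → ℝ), IsPartNearInfinity l a S ρ φ →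
        (a k < 0 → IsForwardSpiralComparable S ρ φ
          (fun x => |x| ^ ((1 : ℝ) / (2 * (k : ℝ))))) ∧
        (0 < a k → IsBackwardSpiralComparable S ρ φ
          (fun x => |x| ^ ((1 : ℝ) / (2 * (k : ℝ))))) ∧
        HasBoxDimUnbounded (polarCurve S ρ φ) (4 * (k : ℝ) / (2 * (k : ℝ) + 1))) := by
  refine ⟨exists_radius_isPartNearInfinity hal, fun ha S ρ φ hS => ?_,
    fun k hk hkl hzero hak S ρ φ hS => ?_⟩
  -- The rate is stated in outward time, hence `|a 0|`; for `a 0 > 0` outward time is the negative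
  -- of the angle up to a constant.
  · refine hS.spiral hal (Nat.zero_le l) (by simp) ha (f₀ := fun x => Real.exp (|a 0| * x))
      (fun u hu c => hu.comparable_exp c) (fun u hu σ hσ θ₀ => hu.hasBoxDim_of_zero hσ θ₀)
      (fun h => ?_) (fun h => ?_)
    · rw [abs_of_neg h]
    · funext x
      rw [abs_of_pos h, neg_mul_neg]
  · refine hS.spiral hal hkl hzero hak (f₀ := fun x => |x| ^ ((1 : ℝ) / (2 * (k : ℝ))))
      (fun u hu c => hu.comparable_rpow hk c) (fun u hu σ hσ θ₀ => hu.hasBoxDim_of_one_le hk hσ θ₀)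
      (fun _ => rfl) (fun _ => ?_)
    funext x
    rw [abs_neg]
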